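/- Fix a logic: a set of sentences with a model-based consequence relation $\models$, each sentence $\alpha$ being written (uniquely) as a non-empty binary word of length $|\alpha|$; put $|\mathcal T|=\sum_{\alpha\in\mathcal T}|\alpha|$ for a finite theory (finite set of sentences) $\mathcal T$. A hypergraph $H=(V,E,\ell)$ consists of a finite set $V$, a set $E$ of hyperedges $(S,d)$ with $S\subseteq V$, $d\in V$, and a map $\ell$ from $V$ to sentences; its size is $|H|=\sum_{(S,d)\in E}\bigl(|\ell(d)|+\sum_{v\in S}|\ell(v)|\bigr)$. A leaf is a vertex that is the target of no hyperedge, a sink is a vertex that lies in the source set of no hyperedge. $H$ is a derivation structure over $\mathcal T$ if every leaf is labelled by an element of $\mathcal T$ and $\{\ell(s)\mid s\in S\}\models\ell(d)$ for all $(S,d)\in E$. It is a proof for $\mathcal T\models\eta$ if moreover it has exactly one sink, this sink is labelled by $\eta$, and $H$ is acyclic (there is no path of positive length from a vertex to itself, where a path goes from an element of $S$ to $d$ for hyperedges $(S,d)$). A homomorphism of hypergraphs is a map of vertices that preserves labels and maps hyperedges to hyperedges (taking the image of $S$ and of $d$). A deriver $\mathfrak D$ consists of a set $C$ of sentences and a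 function that assigns to each finite theory $\mathcal T$ and each $\eta\in C$ a derivation structure $\mathfrak D(\mathcal T,\eta)$ over $\mathcal T$ such that $\mathcal T\models\eta$ iff $\mathfrak D(\mathcal T,\eta)$ contains (as a substructure) a proof for $\mathcal T\models\eta$. It is polynomial if $|\mathfrak D(\mathcal T,\eta)|\le p(|\mathcal T|+|\eta|)$ for some polynomial $p$, and exponential if $|\mathfrak D(\mathcal T,\eta)|\le 2^{p(|\mathcal T|+|\eta|)}$ for some polynomial $p$. The problem $\mathsf{MP}_{\mathsf{binary}}(\mathfrak D)$ is: given a finite theory $\mathcal T$ (as a list of its sentences), $\eta\in C$ and $n\in\mathbb N$ in binary, decide whether there is a proof for $\mathcal T\models\eta$ with at most $n$ vertices that has a homomorphism into $\mathfrak D(\mathcal T,\eta)$. It is written $\mathsf{MP}^{\mathsf{poly}}_{\mathsf{binary}}(\mathfrak D)$ for polynomial and $\mathsf{MP}^{\exp}_{\mathsf{binary}}(\mathfrak D)$ for exponential derivers. Access to derivation structures: the vertices of $\mathfrak D(\mathcal T,\eta)$ are addressed by natural numbers whose binary length is bounded by a polynomial in $|\mathcal T|+|\eta|$, and on input $(\mathcal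 T,\eta,n)$ the machine may use, at unit cost per query, oracles that tell whether a given pair $(S,d)$ is a hyperedge of $\mathfrak D(\mathcal T,\eta)$ and whether a given vertex of it has a given label. Theorem. With this access to $\mathfrak D(\mathcal T,\eta)$, for every polynomial deriver $\mathfrak D$ the problem $\mathsf{MP}^{\mathsf{poly}}_{\mathsf{binary}}(\mathfrak D)$ is in NP, and for every exponential deriver $\mathfrak D$ the problem $\mathsf{MP}^{\exp}_{\mathsf{binary}}(\mathfrak D)$ is in NExpTime. That is, there are a nondeterministic Turing machine and a polynomial $r$ (depending only on $\mathfrak D$) such that every yes-instance with input word of length $N$ has an accepting run of length at most $r(N)$, respectively $2^{r(N)}$, and no no-instance has an accepting run. -/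

import Mathlib

universe u v

namespace MinProof

/-! ## Logics -/

/-- A logic with a model-based consequence relation. Sentences are written as non-empty
binary words (every sentence has at least one symbol). -/
structure Logic where
  Sentence : Type u
  Model : Type v
  Sat : Model → Sentence → Prop
  code : Sentence → List Bool
  code_injective : Function.Injective code
  code_ne_nil : ∀ α, code α ≠ []

/-- `T ⊨ α`: every model of all elements of `T` is a model of `α`. -/
def Logic.Entails (L : Logic.{u, v}) (T : Set L.Sentence) (α : L.Sentence) : Prop :=
  ∀ M : L.Model, (∀ β ∈ T, L.Sat M β) → L.Sat M α

/-- The size `|α|` of a sentence: the number of symbols of its word. -/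
def Logic.size (L : Logic.{u, v}) (α : L.Sentence) : ℕ := (L.code α).length

/-- The size `|T|` of a finite theory. -/
def Logic.theorySize (L : Logic.{u, v}) (T : Finset L.Sentence) : ℕ := ∑ α ∈ T, L.size α

/-! ## Hypergraphs, derivation structures, proofs -/

/-- A finite directed hypergraph whose vertices are labelled by sentences. Vertices are natural
numbers (every finite hypergraph is isomorphic to such a one); the values of `label` outside `V`
are irrelevant. A hyperedge is a pair `(S, d)`. -/
structure Hypergraph (L : Logic.{u, v}) where
  V : Finset ℕ
  E : Finset (Finset ℕ × ℕ)
  source_subset : ∀ e ∈ E, e.1 ⊆ V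
  target_mem : ∀ e ∈ E, e.2 ∈ V
  label : ℕ → L.Sentence

namespace Hypergraph

variable {L : Logic.{u, v}}

/-- `|H|`, the sum of the sizes of the labels of the hyperedges. -/
def size (H : Hypergraph L) : ℕ :=
  ∑ e ∈ H.E, (L.size (H.label e.2) + ∑ w ∈ e.1, L.size (H.label w))

/-- A leaf has no incoming hyperedge. -/
def IsLeaf (H : Hypergraph L) (w : ℕ) : Prop := w ∈ H.V ∧ ∀ e ∈ H.E, e.2 ≠ w

/-- A sink has no outgoing hyperedge. -/
def IsSink (H : Hypergraph L) (w : ℕ) : Prop := w ∈ H.V ∧ ∀ e ∈ H.E, w ∉ e.1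

/-- `s` and `d` are consecutive vertices of some path. -/
def Step (H : Hypergraph L) (s d : ℕ) : Prop := ∃ e ∈ H.E, s ∈ e.1 ∧ e.2 = d

/-- There is no path of positive length from a vertex to itself. -/
def Acyclic (H : Hypergraph L) : Prop := ∀ w, ¬ Relation.TransGen H.Step w w

/-- Every leaf is labelled by an element of `T`. -/
def Grounded (H : Hypergraph L) (T : Finset L.Sentence) : Prop :=
  ∀ w, H.IsLeaf w → H.label w ∈ T

/-- Every hyperedge is a valid entailment. -/
def Sound (H : Hypergraph L) : Prop :=
  ∀ e ∈ H.E, L.Entails {α | ∃ s ∈ e.1, H.label s = α} (H.label e.2)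

/-- `H` is a derivation structure over the finite theory `T`. -/
def IsDerivationStructure (H : Hypergraph L) (T : Finset L.Sentence) : Prop :=
  H.Grounded T ∧ H.Sound

/-- `H` is a proof for `T ⊨ η`: an acyclic derivation structure over `T` with exactly one sink,
which is labelled by `η`. -/
def IsProof (H : Hypergraph L) (T : Finset L.Sentence) (η : L.Sentence) : Prop :=
  H.IsDerivationStructure T ∧ (∃ s, (∀ w, H.IsSink w ↔ w = s) ∧ H.label s = η) ∧ H.Acyclic

/-- `H'` is a substructure of `H`. -/
def IsSubstructure (H' H : Hypergraph L) : Prop :=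
  H'.V ⊆ H.V ∧ H'.E ⊆ H.E ∧ ∀ w ∈ H'.V, H'.label w = H.label w

/-- `h` is a homomorphism from `H` to `H'`. -/
def IsHom (H H' : Hypergraph L) (h : ℕ → ℕ) : Prop :=
  (∀ w ∈ H.V, h w ∈ H'.V) ∧ (∀ e ∈ H.E, (e.1.image h, h e.2) ∈ H'.E) ∧
    ∀ w ∈ H.V, H'.label (h w) = H.label w

end Hypergraph

/-! ## Derivers -/

/-- A deriver: a set of allowed goals, and a derivation structure over `T` for each finite theory
`T` and each allowed goal `η`, which contains a proof for `T ⊨ η` iff `T ⊨ η` holds. -/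
structure Deriver (L : Logic.{u, v}) where
  goals : Set L.Sentence
  out : Finset L.Sentence → goals → Hypergraph L
  isDerivationStructure : ∀ T η, (out T η).IsDerivationStructure T
  entails_iff : ∀ (T : Finset L.Sentence) (η : goals),
    L.Entails (↑T) η ↔ ∃ p : Hypergraph L, p.IsSubstructure (out T η) ∧ p.IsProof T η

namespace Deriver

variable {L : Logic.{u, v}}

/-- `|𝔇(T, η)| ≤ p(|T| + |η|)` for some polynomial `p`. -/
def IsPolynomial (D : Deriver L) : Prop :=
  ∃ p : Polynomial ℕ, ∀ T η, (D.out T η).size ≤ p.eval (L.theorySize T + L.size η)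

/-- `|𝔇(T, η)| ≤ 2 ^ p(|T| + |η|)` for some polynomial `p`. -/
def IsExponential (D : Deriver L) : Prop :=
  ∃ p : Polynomial ℕ, ∀ T η, (D.out T η).size ≤ 2 ^ p.eval (L.theorySize T + L.size η)

/-- The vertices of `𝔇(T, η)` (which are natural numbers, and are used to address them)
have binary representations of length polynomial in `|T| + |η|`. -/
def HasPolynomialIndices (D : Deriver L) : Prop :=
  ∃ q : Polynomial ℕ, ∀ T η, ∀ w ∈ (D.out T η).V,
    w < 2 ^ q.eval (L.theorySize T + L.size η)

/-- `p` is an admissible proof with respect to `𝔇(T, η)`. -/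
def Admissible (D : Deriver L) (T : Finset L.Sentence) (η : D.goals) (p : Hypergraph L) : Prop :=
  p.IsProof T η ∧ ∃ h : ℕ → ℕ, p.IsHom (D.out T η) h

end Deriver

/-! ## Nondeterministic oracle machines -/

/-- The tape alphabet: the two bits and a separator. -/
inductive Sym where
  | bit (b : Bool)
  | sep

/-- A binary word over the tape alphabet. -/
def word (w : List Bool) : List Sym := w.map Sym.bit

/-- The binary representation of a natural number, least significant bit first. -/
def binary (n : ℕ) : List Sym := word n.bits

/-- Instructions of a machine with stacks indexed by `K` and control states `Q`. Each of them
touches at most the top symbol of one stack, except for `query`, which consults the oracle. -/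
inductive Instr (K Q : Type) where
  /-- push a symbol onto a stack -/
  | push (k : K) (a : Sym) (next : Q)
  /-- pop a stack and branch on the popped symbol (`none` if the stack was empty) -/
  | pop (k : K) (next : Option Sym → Q)
  /-- nondeterministic choice -/
  | guess (next₁ next₂ : Q)
  /-- ask the oracle about the word on the query stack, erase that stack, branch on the answer -/
  | query (yes no : Q)
  | accept
  | reject

/-- A nondeterministic oracle Turing machine with finitely many control states, whose memory
consists of finitely many stacks (two stacks are one two-way infinite tape with a head). -/
structure Machine where
  Stack : Type
  State : Type
  [stackFintype : Fintype Stack]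
  [stackDecidableEq : DecidableEq Stack]
  [stateFintype : Fintype State]
  start : State
  inputStack : Stack
  queryStack : Stack
  instr : State → Instr Stack State

attribute [instance] Machine.stackFintype Machine.stackDecidableEq Machine.stateFintype

namespace Machine

/-- A configuration: control state and content of the stacks (the head of a list is the top). -/
structure Cfg (M : Machine) where
  state : M.State
  stk : M.Stack → List Sym

/-- One computation step of `M` with oracle `O`. -/
inductive Step (M : Machine) (O : List Sym → Prop) : M.Cfg → M.Cfg → Prop where
  | push {q s k a q'} (h : M.instr q = .push k a q') :
      Step M O ⟨q, s⟩ ⟨q', Function.update s k (a :: s k)⟩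
  | pop {q s k f} (h : M.instr q = .pop k f) :
      Step M O ⟨q, s⟩ ⟨f (s k).head?, Function.update s k (s k).tail⟩
  | guess_left {q s q₁ q₂} (h : M.instr q = .guess q₁ q₂) : Step M O ⟨q, s⟩ ⟨q₁, s⟩
  | guess_right {q s q₁ q₂} (h : M.instr q = .guess q₁ q₂) : Step M O ⟨q, s⟩ ⟨q₂, s⟩
  | query_yes {q s q₁ q₂} (h : M.instr q = .query q₁ q₂) (ho : O (s M.queryStack)) :
      Step M O ⟨q, s⟩ ⟨q₁, Function.update s M.queryStack []⟩
  | query_no {q s q₁ q₂} (h : M.instr q = .query q₁ q₂) (ho : ¬ O (s M.queryStack)) :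
      Step M O ⟨q, s⟩ ⟨q₂, Function.update s M.queryStack []⟩

/-- `M` can go from one configuration to another in exactly `t` steps. -/
inductive Run (M : Machine) (O : List Sym → Prop) : ℕ → M.Cfg → M.Cfg → Prop where
  | refl (c) : Run M O 0 c c
  | head {t a b c} (h : M.Step O a b) (r : Run M O t b c) : Run M O (t + 1) a c

/-- The initial configuration: `x` on the input stack, all other stacks empty. -/
def init (M : Machine) (x : List Sym) : M.Cfg :=
  ⟨M.start, Function.update (fun _ => []) M.inputStack x⟩

/-- `M` with oracle `O` has an accepting run of length `t` on the input `x`. -/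
def AcceptsIn (M : Machine) (O : List Sym → Prop) (x : List Sym) (t : ℕ) : Prop :=
  ∃ c, M.Run O t (M.init x) c ∧ M.instr c.state = .accept

end Machine

/-! ## Decision problems and complexity classes -/

/-- A decision problem on a type of instances, each written as a word, where for each instance
an oracle is available. -/
structure Problem (I : Type u) where
  encode : I → List Sym
  oracle : I → List Sym → Prop
  Yes : I → Prop

/-- Membership in `NTIME(f)`: one machine accepts each yes-instance `i` by some run of length at
most `f |i|`, and has no accepting run on any no-instance. -/
def Problem.InNTime {I : Type u} (P : Problem I) (f : ℕ → ℕ) : Prop :=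
  ∃ M : Machine, ∀ i : I,
    (P.Yes i → ∃ t ≤ f (P.encode i).length, M.AcceptsIn (P.oracle i) (P.encode i) t) ∧
    (¬ P.Yes i → ∀ t, ¬ M.AcceptsIn (P.oracle i) (P.encode i) t)

/-- Nondeterministic polynomial time. -/
def Problem.InNP {I : Type u} (P : Problem I) : Prop :=
  ∃ p : Polynomial ℕ, P.InNTime fun n => p.eval n

/-- Nondeterministic exponential time. -/
def Problem.InNExpTime {I : Type u} (P : Problem I) : Prop :=
  ∃ p : Polynomial ℕ, P.InNTime fun n => 2 ^ p.eval n

/-! ## The problem of finding minimal proofs -/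

variable {L : Logic.{u, v}}

/-- Instances `(T, η, n)`, where `T` is given by a list of its elements. -/
structure Deriver.Instance (D : Deriver L) where
  theory : Finset L.Sentence
  listing : List L.Sentence
  mem_listing : ∀ α, α ∈ listing ↔ α ∈ theory
  goal : D.goals
  bound : ℕ

/-- The input word of `({α₁, …, αₖ}, η, n)`: each `αᵢ` is followed by
`#`, then come another `#`, the goal `η`, another `#` and the number `n` in binary. -/
def Deriver.Instance.encode {D : Deriver L} (i : D.Instance) : List Sym :=
  (i.listing.flatMap fun α => word (L.code α) ++ [Sym.sep]) ++
    [Sym.sep] ++ word (L.code i.goal) ++ [Sym.sep] ++ binary i.bound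

/-- The query "is `({v₁, …, vₖ}, d)` a hyperedge?", written as `0v₁#…vₖ#d`. -/
def edgeQuery (vs : List ℕ) (d : ℕ) : List Sym :=
  [Sym.bit false] ++ (vs.flatMap fun w => binary w ++ [Sym.sep]) ++ binary d

/-- The query "is the vertex `w` labelled by `α`?", written as `1w#α`. -/
def labelQuery (w : ℕ) (α : L.Sentence) : List Sym :=
  [Sym.bit true] ++ binary w ++ [Sym.sep] ++ word (L.code α)

/-- The oracle functions of a hypergraph: hyperedge queries and label queries. -/
def Hypergraph.oracle (H : Hypergraph L) (x : List Sym) : Prop :=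
  (∃ vs d, x = edgeQuery vs d ∧ (vs.toFinset, d) ∈ H.E) ∨
    ∃ w ∈ H.V, x = labelQuery w (H.label w)

/-- `MP(𝔇)` with binary coding of numbers: given `(T, η, n)`, decide whether there is an
admissible proof with respect to `𝔇(T, η)` that has at most `n` vertices. -/
def Deriver.MPbinary (D : Deriver L) : Problem D.Instance where
  encode i := i.encode
  oracle i := (D.out i.theory i.goal).oracle
  Yes i := ∃ p : Hypergraph L, D.Admissible i.theory i.goal p ∧ p.V.card ≤ i.bound

end MinProof

/-! The existence of a small admissible proof is a statement about the vertices of `𝔇(T, η)` alone.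
The image of an acyclic proof under a homomorphism may contain cycles, but if each image vertex is
ranked by the least number of ancestors of a preimage, then it is labelled in `T` or derived by a
hyperedge from image vertices of smaller rank (`IsProof.founded_image`). Conversely, one such
hyperedge per vertex not labelled in `T`, restricted to what leads to a given vertex, forms a proof
(`Founded.exists_isProof`). Sorted by rank, such a set becomes a list in which earlier vertices
justify later ones (`ValidList`). So yes-instances are those with a valid list of length at most `n`
that contains a vertex labelled `η`.

Since `n` is given in binary, it does not bound the running time suitably. But a vertex that is no
source of a hyperedge is useless unless it is the conclusion, and there are at most `|𝔇(T, η)|`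
sources because labels are non-empty words; so length `|𝔇(T, η)| + 1` suffices
(`Admissible.exists_validList`).

The machine `guesser` guesses such a list, decrements a binary counter and asks one oracle query per
vertex, and accepts at a vertex labelled `η`. Acceptance within `k` steps is monotone in `k` and is
traced through the program by equivalences. Enlarging `k` freely gives soundness (`yes_of_acc`);
careful counting gives a time bound polynomial in `|𝔇(T, η)|`, the input length and the address
length (`acc_of_yes`). -/

namespace MinProof

/-! ### Proofs, founded vertex sets and valid lists -/

namespace Hypergraph

variable {L : Logic.{u, v}}

/-- `K` carries a rank function along which every vertex of `K` is derived from `T` by an edge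
with sources in `K` of smaller rank, unless it is labelled by an element of `T`. -/
def Founded (H : Hypergraph L) (T : Finset L.Sentence) (K : Finset ℕ) : Prop :=
  ∃ rk : ℕ → ℕ, ∀ w ∈ K, w ∈ H.V ∧
    (H.label w ∈ T ∨ ∃ S, (S, w) ∈ H.E ∧ ∀ u ∈ S, u ∈ K ∧ rk u < rk w)

/-- Every vertex of the list is labelled by an element of `T`, or is the target of a hyperedge
whose sources occur earlier in the list. -/
inductive ValidList (H : Hypergraph L) (T : Finset L.Sentence) : List ℕ → Prop
  | nil : ValidList H T []
  | snoc {l : List ℕ} {w : ℕ} (hl : ValidList H T l) (hw : w ∈ H.V)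
      (h : H.label w ∈ T ∨ ∃ S, (S, w) ∈ H.E ∧ ∀ u ∈ S, u ∈ l) : ValidList H T (l ++ [w])

theorem ValidList.founded {H : Hypergraph L} {T : Finset L.Sentence} {l : List ℕ}
    (h : H.ValidList T l) : H.Founded T l.toFinset := by
  induction h with
  | nil => exact ⟨fun _ => 0, by simp⟩
  | @snoc l w hl hw h ih =>
    obtain ⟨rk, hrk⟩ := ih
    -- The new vertex is ranked above all earlier ones; a repeated vertex keeps its old rank.
    refine ⟨fun u => if u ∈ l then rk u else 1 + ∑ x ∈ l.toFinset, rk x, fun u hu => ?_⟩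
    by_cases hul : u ∈ l
    · obtain ⟨h1, h2⟩ := hrk u (by simpa using hul)
      refine ⟨h1, h2.imp_right ?_⟩
      rintro ⟨S, hS, hS'⟩
      refine ⟨S, hS, fun x hx => ?_⟩
      obtain ⟨h3, h4⟩ := hS' x hx
      have h3' : x ∈ l := by simpa using h3
      simp [hul, h3', h4]
    · have huw : u = w := by simpa [hul] using hu
      subst huw
      refine ⟨hw, h.imp_right ?_⟩
      rintro ⟨S, hS, hS'⟩
      refine ⟨S, hS, fun x hx => ?_⟩
      have hx' := hS' x hx
      have : rk x ≤ ∑ x ∈ l.toFinset, rk x :=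
        Finset.single_le_sum (f := rk) (fun _ _ => Nat.zero_le _) (by simpa using hx')
      simp only [List.toFinset_append, Finset.mem_union, List.mem_toFinset, hx', true_or, true_and,
        if_true, hul, if_false]
      omega

/-- A vertex of maximal rank justifies no other vertex of `K`, so it can be removed and put last. -/
theorem Founded.exists_validList {H : Hypergraph L} {T : Finset L.Sentence} {K : Finset ℕ}
    (h : H.Founded T K) : ∃ l, H.ValidList T l ∧ l.Nodup ∧ l.toFinset = K := by
  obtain ⟨rk, h⟩ := h
  induction hn : K.card generalizing K with
  | zero =>
    obtain rfl := Finset.card_eq_zero.1 hn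
    exact ⟨[], .nil, .nil, rfl⟩
  | succ n ih =>
    obtain ⟨w, hw, hmax⟩ := K.exists_max_image rk (Finset.card_pos.1 (by omega))
    have key : ∀ u ∈ K, ∀ x ∈ K, rk x < rk u → x ∈ K.erase w := by
      intro u hu x hx hlt
      refine Finset.mem_erase.2 ⟨?_, hx⟩
      rintro rfl
      exact absurd (hmax u hu) (by omega)
    obtain ⟨l, hl, hnd, hlK⟩ := ih (K := K.erase w) (fun u hu => by
      obtain ⟨h1, h2⟩ := h u (Finset.mem_of_mem_erase hu)
      refine ⟨h1, h2.imp_right ?_⟩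
      rintro ⟨S, hS, hS'⟩
      exact ⟨S, hS, fun x hx =>
        ⟨key u (Finset.mem_of_mem_erase hu) x (hS' x hx).1 (hS' x hx).2, (hS' x hx).2⟩⟩)
      (by rw [Finset.card_erase_of_mem hw, hn]; rfl)
    refine ⟨l ++ [w], .snoc hl (h w hw).1 ((h w hw).2.imp_right ?_), ?_, ?_⟩
    · rintro ⟨S, hS, hS'⟩
      refine ⟨S, hS, fun x hx => ?_⟩
      have := key w hw x (hS' x hx).1 (hS' x hx).2
      rw [← hlK] at this
      simpa using this
    · have hwl : w ∉ l := by
        rw [← List.mem_toFinset, hlK]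
        exact Finset.notMem_erase _ _
      exact List.nodup_append.2 ⟨hnd, List.nodup_singleton _, fun a ha b hb hab =>
        hwl (List.mem_singleton.1 hb ▸ hab ▸ ha)⟩
    · rw [List.toFinset_append, hlK]
      ext x
      by_cases hx : x = w <;> simp [hx, hw]

/-- A vertex of a founded set is the conclusion of a proof inside that set. -/
theorem Founded.exists_isProof {H : Hypergraph L} {T : Finset L.Sentence} {K : Finset ℕ}
    (hH : H.Sound) (h : H.Founded T K) {g : ℕ} (hg : g ∈ K) :
    ∃ p : Hypergraph L, p.IsProof T (H.label g) ∧ p.IsHom H id ∧ p.V ⊆ K := by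
  classical
  obtain ⟨rk, h⟩ := h
  choose! hV hd using h
  have hd' : ∀ w, ∃ S, w ∈ K → H.label w ∉ T → (S, w) ∈ H.E ∧ ∀ u ∈ S, u ∈ K ∧ rk u < rk w := by
    intro w
    by_cases hw : w ∈ K ∧ H.label w ∉ T
    · obtain ⟨S, hS⟩ := (hd w hw.1).resolve_left hw.2
      exact ⟨S, fun _ _ => hS⟩
    -- Junk value: no hyperedge is selected for vertices labelled in `T` or outside `K`.
    · exact ⟨∅, fun h1 h2 => absurd ⟨h1, h2⟩ hw⟩
  choose src hsrc using hd'
  -- Only selected hyperedges count, so vertices labelled in `T` become leaves even if `H` has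
  -- hyperedges into them.
  let st : ℕ → ℕ → Prop := fun a b => b ∈ K ∧ H.label b ∉ T ∧ a ∈ src b
  have st_lt : ∀ a b, st a b → rk a < rk b := fun a b hab =>
    ((hsrc b hab.1 hab.2.1).2 a hab.2.2).2
  have refl_le : ∀ a b, Relation.ReflTransGen st a b → rk a ≤ rk b := by
    intro a b hab
    induction hab with
    | refl => exact le_rfl
    | tail _ hbc ih => exact ih.trans (st_lt _ _ hbc).le
  -- Keeping only what leads to `g` leaves no sink besides `g`; `g` is a sink because ranks increase
  -- along `st`.
  let V : Finset ℕ := K.filter fun w => Relation.ReflTransGen st w g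
  let E : Finset (Finset ℕ × ℕ) := (V.filter fun w => H.label w ∉ T).image fun w => (src w, w)
  have memV : ∀ w, w ∈ V ↔ w ∈ K ∧ Relation.ReflTransGen st w g := fun w => Finset.mem_filter
  have memE : ∀ e, e ∈ E ↔ e.2 ∈ V ∧ H.label e.2 ∉ T ∧ e.1 = src e.2 := by
    rintro ⟨S, d⟩
    simp only [E, Finset.mem_image, Finset.mem_filter, Prod.mk.injEq]
    constructor
    · rintro ⟨w, ⟨h1, h2⟩, h3, rfl⟩
      exact ⟨h1, h2, h3.symm⟩
    · rintro ⟨h1, h2, h3⟩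
      exact ⟨d, ⟨h1, h2⟩, h3.symm, rfl⟩
  have src_st : ∀ e ∈ E, ∀ u ∈ e.1, st u e.2 := by
    intro e he u hu
    obtain ⟨h1, h2, h3⟩ := (memE e).1 he
    exact ⟨((memV _).1 h1).1, h2, h3 ▸ hu⟩
  have E_sub : ∀ e ∈ E, e ∈ H.E := by
    intro e he
    obtain ⟨h1, h2, h3⟩ := (memE e).1 he
    have := (hsrc e.2 ((memV _).1 h1).1 h2).1
    rwa [← h3] at this
  let p : Hypergraph L :=
    { V := V
      E := E
      source_subset := by
        intro e he u hu
        have hst := src_st e he u hu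
        exact (memV u).2 ⟨((hsrc e.2 hst.1 hst.2.1).2 u hst.2.2).1,
          .head hst ((memV _).1 ((memE e).1 he).1).2⟩
      target_mem := fun e he => ((memE e).1 he).1
      label := H.label }
  have step_lt : ∀ a b, p.Step a b → rk a < rk b := by
    rintro a b ⟨e, he, hae, rfl⟩
    exact st_lt _ _ (src_st e he a hae)
  refine ⟨p, ⟨⟨?_, ?_⟩, ⟨g, ?_, rfl⟩, ?_⟩, ⟨?_, ?_, fun _ _ => rfl⟩, Finset.filter_subset _ _⟩
  · rintro w ⟨hw, hleaf⟩
    by_contra hT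
    exact hleaf (src w, w) ((memE _).2 ⟨hw, hT, rfl⟩) rfl
  · exact fun e he => hH e (E_sub e he)
  · intro w
    constructor
    · rintro ⟨hw, hsink⟩
      rcases Relation.ReflTransGen.cases_head ((memV w).1 hw).2 with h1 | ⟨c, hwc, hcg⟩
      · exact h1
      · exact absurd hwc.2.2
          (hsink (src c, c) ((memE _).2 ⟨(memV c).2 ⟨hwc.1, hcg⟩, hwc.2.1, rfl⟩))
    · rintro rfl
      refine ⟨(memV w).2 ⟨hg, .refl⟩, fun e he hwe => ?_⟩
      have h1 := st_lt _ _ (src_st e he w hwe)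
      have h2 := refl_le _ _ ((memV _).1 ((memE e).1 he).1).2
      omega
  · intro w hw
    have : ∀ a b, Relation.TransGen p.Step a b → rk a < rk b := by
      intro a b hab
      induction hab with
      | single h => exact step_lt _ _ h
      | tail _ h ih => exact ih.trans (step_lt _ _ h)
    exact lt_irrefl _ (this w w hw)
  · exact fun w hw => hV w ((memV w).1 hw).1
  · intro e he
    simpa using E_sub e he

/-- The image of a proof under a homomorphism is founded. -/
theorem IsProof.founded_image {H p : Hypergraph L} {T : Finset L.Sentence} {η : L.Sentence}
    (hp : p.IsProof T η) {h : ℕ → ℕ} (hh : p.IsHom H h) : H.Founded T (p.V.image h) := by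
  classical
  obtain ⟨⟨hgr, -⟩, -, hac⟩ := hp
  obtain ⟨hV, hE, hlab⟩ := hh
  -- The number of proper ancestors. It increases strictly along steps: by acyclicity the source is
  -- an ancestor of the target but not of itself.
  let rk : ℕ → ℕ := fun w => (p.V.filter fun u => Relation.TransGen p.Step u w).card
  have rk_lt : ∀ a b, a ∈ p.V → p.Step a b → rk a < rk b := by
    intro a b ha hab
    refine Finset.card_lt_card ⟨fun x hx => ?_, fun hsub => ?_⟩
    · obtain ⟨h1, h2⟩ := Finset.mem_filter.1 hx
      exact Finset.mem_filter.2 ⟨h1, h2.tail hab⟩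
    · have ha' : a ∈ p.V.filter fun u => Relation.TransGen p.Step u b :=
        Finset.mem_filter.2 ⟨ha, .single hab⟩
      have := hsub ha'
      exact hac a (Finset.mem_filter.1 this).2
  -- The minimum over the fibre; a preimage attaining it supplies the justifying hyperedge.
  let rk' : ℕ → ℕ := fun x => sInf (rk '' {w | w ∈ p.V ∧ h w = x})
  refine ⟨rk', fun x hx => ?_⟩
  obtain ⟨w₀, hw₀, hx₀⟩ := Finset.mem_image.1 hx
  obtain ⟨w, ⟨hw, rfl⟩, hmin⟩ : rk' x ∈ rk '' {w | w ∈ p.V ∧ h w = x} :=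
    Nat.sInf_mem ⟨_, w₀, ⟨hw₀, hx₀⟩, rfl⟩
  refine ⟨hV w hw, ?_⟩
  by_cases hleaf : p.IsLeaf w
  · exact .inl (by rw [hlab w hw]; exact hgr w hleaf)
  · obtain ⟨e, he, hew⟩ : ∃ e ∈ p.E, e.2 = w := by
      by_contra hcon
      push Not at hcon
      exact hleaf ⟨hw, hcon⟩
    refine .inr ⟨e.1.image h, hew ▸ hE e he, fun y hy => ?_⟩
    obtain ⟨u, hu, rfl⟩ := Finset.mem_image.1 hy
    have huV := p.source_subset e he hu
    refine ⟨Finset.mem_image_of_mem _ huV, ?_⟩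
    rw [← hmin]
    have hmem : rk u ∈ rk '' {w | w ∈ p.V ∧ h w = h u} := ⟨u, ⟨huV, rfl⟩, rfl⟩
    exact (Nat.sInf_le hmem).trans_lt (rk_lt u w huV ⟨e, he, hu, hew⟩)

/-- All vertices that occur in some source set. -/
def sources (H : Hypergraph L) : Finset ℕ := H.E.biUnion Prod.fst

/-- Each occurrence of a source contributes the length of a non-empty word to `|H|`. Isolated
vertices contribute nothing, so `H.V` itself admits no such bound. -/
theorem card_sources_le (H : Hypergraph L) : H.sources.card ≤ H.size := by
  refine Finset.card_biUnion_le.trans (Finset.sum_le_sum fun e _ => ?_)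
  refine le_trans ?_ (Nat.le_add_left _ _)
  rw [Finset.card_eq_sum_ones]
  exact Finset.sum_le_sum fun w _ => List.length_pos_iff.2 (L.code_ne_nil _)

/-- Justifications use only sources of hyperedges, so apart from `g` all other vertices can be
dropped. -/
theorem Founded.inter_sources {H : Hypergraph L} {T : Finset L.Sentence} {K : Finset ℕ}
    (h : H.Founded T K) {g : ℕ} (hg : g ∈ K) : H.Founded T (insert g (K ∩ H.sources)) := by
  obtain ⟨rk, h⟩ := h
  refine ⟨rk, fun w hw => ?_⟩
  have hwK : w ∈ K := by
    rcases Finset.mem_insert.1 hw with rfl | hw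
    · exact hg
    · exact (Finset.mem_inter.1 hw).1
  refine ⟨(h w hwK).1, (h w hwK).2.imp_right ?_⟩
  rintro ⟨S, hS, hS'⟩
  exact ⟨S, hS, fun u hu => ⟨Finset.mem_insert_of_mem (Finset.mem_inter.2
    ⟨(hS' u hu).1, Finset.mem_biUnion.2 ⟨_, hS, hu⟩⟩), (hS' u hu).2⟩⟩

end Hypergraph

/-! ### Admissible proofs as short valid lists -/

namespace Deriver

variable {L : Logic.{u, v}}

theorem exists_admissible_of_validList (D : Deriver L) {T : Finset L.Sentence} {η : D.goals}
    {l : List ℕ} (hl : (D.out T η).ValidList T l) {g : ℕ} (hg : g ∈ l)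
    (hη : (D.out T η).label g = η) :
    ∃ p : Hypergraph L, D.Admissible T η p ∧ p.V.card ≤ l.length := by
  obtain ⟨p, h1, h2, h3⟩ := hl.founded.exists_isProof (D.isDerivationStructure T η).2
    (List.mem_toFinset.2 hg)
  exact ⟨p, ⟨hη ▸ h1, id, h2⟩, (Finset.card_le_card h3).trans l.toFinset_card_le⟩

/-- The list enumerates the conclusion and the sources in the image of the proof, whence both length
bounds. Absence of repetitions is what the final goal test of the machine relies on. -/
theorem Admissible.exists_validList {D : Deriver L} {T : Finset L.Sentence} {η : D.goals}
    {p : Hypergraph L} (hp : D.Admissible T η p) :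
    ∃ l, (D.out T η).ValidList T l ∧ l.Nodup ∧ l.length ≤ p.V.card ∧
      l.length ≤ (D.out T η).size + 1 ∧ ∃ g ∈ l, (D.out T η).label g = η := by
  obtain ⟨hp, h, hh⟩ := hp
  have hf := hp.founded_image hh
  obtain ⟨-, ⟨s, hs, hsη⟩, -⟩ := hp
  have hsV : s ∈ p.V := ((hs s).2 rfl).1
  have hg : h s ∈ p.V.image h := Finset.mem_image_of_mem _ hsV
  obtain ⟨l, hl, hnd, hlK⟩ := (hf.inter_sources hg).exists_validList
  have hlen := List.toFinset_card_of_nodup hnd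
  rw [hlK] at hlen
  refine ⟨l, hl, hnd, ?_, ?_, h s, ?_, ?_⟩
  · rw [← hlen]
    refine (Finset.card_le_card ?_).trans (Finset.card_image_le (s := p.V) (f := h))
    exact Finset.insert_subset hg Finset.inter_subset_left
  · rw [← hlen]
    refine (Finset.card_insert_le _ _).trans (Nat.succ_le_succ ?_)
    exact (Finset.card_le_card Finset.inter_subset_right).trans (Hypergraph.card_sources_le _)
  · rw [← List.mem_toFinset, hlK]
    exact Finset.mem_insert_self _ _
  · rw [hh.2.2 s hsV, hsη]

end Deriver

/-! ### Acceptance within a time budget -/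

namespace Machine

variable (M : Machine) (O : List Sym → Prop)

/-- `M` has an accepting run of length at most `k` from the configuration `c`. -/
def AcceptsWithin (k : ℕ) (c : M.Cfg) : Prop :=
  ∃ t ≤ k, ∃ c', M.Run O t c c' ∧ M.instr c'.state = .accept

variable {M O}

theorem AcceptsWithin.mono {k k' : ℕ} {c : M.Cfg} (h : M.AcceptsWithin O k c) (hk : k ≤ k') :
    M.AcceptsWithin O k' c := by
  obtain ⟨t, ht, h⟩ := h
  exact ⟨t, ht.trans hk, h⟩

theorem acceptsWithin_of_accept {k : ℕ} {c : M.Cfg} (h : M.instr c.state = .accept) :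
    M.AcceptsWithin O k c :=
  ⟨0, Nat.zero_le _, c, .refl c, h⟩

theorem not_acceptsWithin_zero {c : M.Cfg} (h : M.instr c.state ≠ .accept) :
    ¬ M.AcceptsWithin O 0 c := by
  rintro ⟨t, ht, c', hr, hc'⟩
  cases hr with
  | refl => exact h hc'
  | head => omega

/-- One instruction costs one unit of the budget. The form of an equivalence lets the same rules
construct accepting runs and analyse arbitrary ones. -/
theorem acceptsWithin_succ {k : ℕ} {c : M.Cfg} (h : M.instr c.state ≠ .accept) :
    M.AcceptsWithin O (k + 1) c ↔ ∃ c', M.Step O c c' ∧ M.AcceptsWithin O k c' := by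
  constructor
  · rintro ⟨t, ht, c', hr, hc'⟩
    cases hr with
    | refl => exact absurd hc' h
    | head hs hr => exact ⟨_, hs, _, by omega, _, hr, hc'⟩
  · rintro ⟨b, hs, t, ht, c', hr, hc'⟩
    exact ⟨t + 1, by omega, c', .head hs hr, hc'⟩

theorem not_acceptsWithin_of_reject {k : ℕ} {c : M.Cfg} (h : M.instr c.state = .reject) :
    ¬ M.AcceptsWithin O k c := by
  rintro ⟨t, ht, c', hr, hc'⟩
  cases hr with
  | refl => simp [h] at hc'
  | head hs _ => cases hs <;> simp_all

theorem acceptsWithin_push {k : ℕ} {q q' : M.State} {s : M.Stack → List Sym} {j : M.Stack} {a : Sym}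
    (h : M.instr q = .push j a q') :
    M.AcceptsWithin O (k + 1) ⟨q, s⟩ ↔
      M.AcceptsWithin O k ⟨q', Function.update s j (a :: s j)⟩ := by
  rw [acceptsWithin_succ (by simp [h])]
  constructor
  · rintro ⟨c', hs, hc'⟩
    cases hs <;> simp_all
  · exact fun hc => ⟨_, .push h, hc⟩

theorem acceptsWithin_pop {k : ℕ} {q : M.State} {s : M.Stack → List Sym} {j : M.Stack}
    {f : Option Sym → M.State} (h : M.instr q = .pop j f) :
    M.AcceptsWithin O (k + 1) ⟨q, s⟩ ↔
      M.AcceptsWithin O k ⟨f (s j).head?, Function.update s j (s j).tail⟩ := by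
  rw [acceptsWithin_succ (by simp [h])]
  constructor
  · rintro ⟨c', hs, hc'⟩
    cases hs <;> simp_all
  · exact fun hc => ⟨_, .pop h, hc⟩

theorem acceptsWithin_guess {k : ℕ} {q q₁ q₂ : M.State} {s : M.Stack → List Sym}
    (h : M.instr q = .guess q₁ q₂) :
    M.AcceptsWithin O (k + 1) ⟨q, s⟩ ↔
      M.AcceptsWithin O k ⟨q₁, s⟩ ∨ M.AcceptsWithin O k ⟨q₂, s⟩ := by
  rw [acceptsWithin_succ (by simp [h])]
  constructor
  · rintro ⟨c', hs, hc'⟩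
    cases hs <;> simp_all
  · rintro (hc | hc)
    · exact ⟨_, .guess_left h, hc⟩
    · exact ⟨_, .guess_right h, hc⟩

theorem acceptsWithin_query {k : ℕ} {q q₁ q₂ : M.State} {s : M.Stack → List Sym}
    (h : M.instr q = .query q₁ q₂) :
    M.AcceptsWithin O (k + 1) ⟨q, s⟩ ↔
      (O (s M.queryStack) ∧
        M.AcceptsWithin O k ⟨q₁, Function.update s M.queryStack []⟩) ∨
      (¬ O (s M.queryStack) ∧
        M.AcceptsWithin O k ⟨q₂, Function.update s M.queryStack []⟩) := by
  rw [acceptsWithin_succ (by simp [h])]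
  constructor
  · rintro ⟨c', hs, hc'⟩
    cases hs <;> simp_all
  · rintro (⟨ho, hc⟩ | ⟨ho, hc⟩)
    · exact ⟨_, .query_yes h ho, hc⟩
    · exact ⟨_, .query_no h ho, hc⟩

/-- A loop that moves all symbols of the stack `j₁` to the stack `j₂`. -/
theorem acceptsWithin_move {q q₁ : M.State} {r : Sym → M.State} {j₁ j₂ : M.Stack}
    (hne : j₁ ≠ j₂) (hq : M.instr q = .pop j₁ fun o => o.elim q₁ r)
    (hr : ∀ x, M.instr (r x) = .push j₂ x q) {k : ℕ} (s : M.Stack → List Sym) :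
    M.AcceptsWithin O (k + 2 * (s j₁).length + 1) ⟨q, s⟩ ↔
      M.AcceptsWithin O k
        ⟨q₁, Function.update (Function.update s j₁ []) j₂ ((s j₁).reverse ++ s j₂)⟩ := by
  induction hl : s j₁ generalizing s with
  | nil =>
    rw [List.length_nil, Nat.mul_zero, Nat.add_zero, acceptsWithin_pop hq, hl]
    refine iff_of_eq (congrArg (fun t => M.AcceptsWithin O k ⟨q₁, t⟩) ?_)
    have : s j₂ = Function.update s j₁ [] j₂ := (Function.update_of_ne hne.symm _ _).symm
    rw [List.reverse_nil, List.nil_append, this, Function.update_eq_self]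
    rfl
  | cons x l ih =>
    rw [List.length_cons, Nat.mul_succ, ← Nat.add_assoc, acceptsWithin_pop hq, hl]
    simp only [List.head?_cons, Option.elim_some, List.tail_cons]
    rw [acceptsWithin_push (hr x), ih _ (by simp [Function.update_of_ne hne])]
    refine iff_of_eq (congrArg _ (congrArg _ ?_))
    funext y
    by_cases h2 : y = j₂
    · subst h2
      simp [Function.update_of_ne hne.symm]
    · by_cases h1 : y = j₁
      · subst h1
        simp [Function.update_of_ne hne]
      · simp [Function.update_of_ne h1, Function.update_of_ne h2]

end Machine

-- The guessing machine

deriving instance Fintype for Sym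

/-- What the vertex that is being processed is checked for: to be labelled by a sentence of the
theory, to be the target of a hyperedge, or to be labelled by the goal. -/
inductive Mode where
  | thy
  | edge
  | goal
deriving DecidableEq

instance : Fintype Mode where
  elems := {.thy, .edge, .goal}
  complete m := by cases m <;> decide

/-- Whether to use a label query. -/
def Mode.label : Mode → Bool
  | .edge => false
  | _ => true

/-- The stacks of the machine `guesser`. -/
inductive Stk where
  -- After parsing, `inp` holds the counter; `z` collects zeros during a decrement. The theory rests
  -- in `tb` and the guessed vertices in `lb`, last symbol on top; scanning shifts them to `tf` and
  -- `lf`, and the `move` states carry them back.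
  | inp
  | goal
  | q
  | z
  | tb
  | tf
  | lb
  | lf
deriving DecidableEq

instance : Fintype Stk where
  elems := {.inp, .goal, .q, .z, .tb, .tf, .lb, .lf}
  complete j := by cases j <;> decide

/-- The control states of the machine `guesser`. -/
inductive St where
  | parse
  | parseWord
  | parsePush (b : Bool)
  | parseSep
  | parseGoal
  | parseGoalPush (b : Bool)
  | main
  | dec
  | decZero
  | decOne
  | decBack
  | decBackPush
  | choose
  | skip
  | skipPush (b : Bool)
  | skipSep
  | skipGuess
  | copy
  | copyPush (b : Bool)
  | copyPushQ (b : Bool)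
  | copySep
  | pickEnd
  | new (m : Mode)
  | newGuess (m : Mode)
  | newBit (m : Mode)
  | newPush (m : Mode) (b : Bool)
  | newPushQ (m : Mode) (b : Bool)
  | selStart (m : Mode)
  | sel (m : Mode) (c : Bool)
  | selPush (m : Mode) (c b : Bool)
  | selPushQ (m : Mode) (b : Bool)
  | selSep (m : Mode)
  | selGuess (m : Mode)
  | selSepQ (m : Mode)
  | ask (m : Mode)
  | query (m : Mode)
  | move (m : Mode)
  | movePush (m : Mode) (a : Sym)
  | acc
  | rej
deriving Fintype

/-- The program of the machine `guesser`. -/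
def instr : St → Instr Stk St
  | .parse => .pop .inp fun
    | none => .rej
    | some (.bit b) => .parsePush b
    -- Sentences are non-empty words, so a separator where a word should start ends the theory.
    | some .sep => .parseGoal
  | .parseWord => .pop .inp fun
    | none => .rej
    | some (.bit b) => .parsePush b
    | some .sep => .parseSep
  | .parsePush b => .push .tb (.bit b) .parseWord
  | .parseSep => .push .tb .sep .parse
  | .parseGoal => .pop .inp fun
    | none => .rej
    | some (.bit b) => .parseGoalPush b
    | some .sep => .main
  | .parseGoalPush b => .push .goal (.bit b) .parseGoal
  | .main => .guess (.move .goal) .dec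
  | .dec => .pop .inp fun
    -- No digit one was found: the counter is zero and no further vertex is allowed.
    | none => .rej
    | some (.bit b) => bif b then .decOne else .decZero
    | some .sep => .rej
  | .decZero => .push .z (.bit false) .dec
  | .decOne => .push .inp (.bit false) .decBack
  | .decBack => .pop .z fun
    | none => .choose
    | some _ => .decBackPush
  | .decBackPush => .push .inp (.bit true) .decBack
  | .choose => .guess .skip (.new .edge)
  | .skip => .pop .tb fun
    | none => .rej
    | some (.bit b) => .skipPush b
    | some .sep => .skipSep
  | .skipPush b => .push .tf (.bit b) .skip
  | .skipSep => .push .tf .sep .skipGuess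
  | .skipGuess => .guess .skip .copy
  | .copy => .pop .tb fun
    | none => .pickEnd
    | some (.bit b) => .copyPush b
    | some .sep => .copySep
  | .copyPush b => .push .tf (.bit b) (.copyPushQ b)
  | .copyPushQ b => .push .q (.bit b) .copy
  | .copySep => .push .tf .sep .pickEnd
  | .pickEnd => .push .q .sep (.move .thy)
  | .new m => .push .lf .sep (.newGuess m)
  | .newGuess m => .guess (.selStart m) (.newBit m)
  | .newBit m => .guess (.newPush m false) (.newPush m true)
  | .newPush m b => .push .lf (.bit b) (.newPushQ m b)
  | .newPushQ m b => .push .q (.bit b) (.newGuess m)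
  -- Both branches agree: the flag, which says whether the current word is copied into the query, is
  -- irrelevant on an empty stack or in front of a separator.
  | .selStart m => .guess (.sel m false) (.sel m true)
  | .sel m c => .pop .lb fun
    | none => .ask m
    | some (.bit b) => .selPush m c b
    | some .sep => .selSep m
  | .selPush m c b => .push .lf (.bit b) (bif c then .selPushQ m b else .sel m false)
  | .selPushQ m b => .push .q (.bit b) (.sel m true)
  | .selSep m => .push .lf .sep (.selGuess m)
  | .selGuess m => .guess (.sel m false) (.selSepQ m)
  | .selSepQ m => .push .q .sep (.sel m true)
  | .ask m => .push .q (.bit m.label) (.query m)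
  | .query m => .query (match m with | .goal => .acc | _ => .move .edge) .rej
  | .move .goal => .pop .goal fun o => o.elim (.selStart .goal) (.movePush .goal)
  | .move .thy => .pop .tf fun o => o.elim (.new .thy) (.movePush .thy)
  | .move .edge => .pop .lf fun o => o.elim .main (.movePush .edge)
  | .movePush .goal a => .push .q a (.move .goal)
  | .movePush .thy a => .push .tb a (.move .thy)
  | .movePush .edge a => .push .lb a (.move .edge)
  | .acc => .accept
  | .rej => .reject

/-- The nondeterministic machine that guesses a list of vertices, each of which it verifies to be
labelled by an element of the theory or to be derived from earlier vertices. -/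
def guesser : Machine where
  Stack := Stk
  State := St
  start := .parse
  inputStack := .inp
  queryStack := .q
  instr := instr

/-! ### Symbolic execution of the program -/

/-- The contents of the stacks of `guesser`. -/
structure Mem where
  inp : List Sym
  goal : List Sym
  q : List Sym
  z : List Sym
  tb : List Sym
  tf : List Sym
  lb : List Sym
  lf : List Sym

namespace Mem

/-- The content of a stack. -/
def get (m : Mem) : Stk → List Sym
  | .inp => m.inp
  | .goal => m.goal
  | .q => m.q
  | .z => m.z
  | .tb => m.tb
  | .tf => m.tf
  | .lb => m.lb
  | .lf => m.lf

/-- Replace the content of a stack. -/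
def set (m : Mem) (j : Stk) (x : List Sym) : Mem :=
  match j with
  | .inp => { m with inp := x }
  | .goal => { m with goal := x }
  | .q => { m with q := x }
  | .z => { m with z := x }
  | .tb => { m with tb := x }
  | .tf => { m with tf := x }
  | .lb => { m with lb := x }
  | .lf => { m with lf := x }

theorem update_get (m : Mem) (j : Stk) (x : List Sym) :
    Function.update m.get j x = (m.set j x).get := by
  funext y
  cases j <;> cases y <;> rfl

end Mem

/-- `guesser` has an accepting run of length at most `k` from the given configuration. -/
def Acc (O : List Sym → Prop) (k : ℕ) (q : St) (m : Mem) : Prop :=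
  guesser.AcceptsWithin O k ⟨q, m.get⟩

/-- Acceptance within `k + 1` steps, if the current instruction is the given one. -/
def AccNext (O : List Sym → Prop) (k : ℕ) (m : Mem) : Instr Stk St → Prop
  | .push j a q => Acc O k q (m.set j (a :: m.get j))
  | .pop j f => Acc O k (f (m.get j).head?) (m.set j (m.get j).tail)
  | .guess q₁ q₂ => Acc O k q₁ m ∨ Acc O k q₂ m
  | .query q₁ q₂ => (O m.q ∧ Acc O k q₁ (m.set .q [])) ∨ (¬ O m.q ∧ Acc O k q₂ (m.set .q []))
  | .accept => True
  | .reject => False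

section Program

variable {O : List Sym → Prop} {k : ℕ}

/-- Since `instr q` reduces by computation, one use of this rule executes one instruction. -/
theorem acc_succ {q : St} {m : Mem} : Acc O (k + 1) q m ↔ AccNext O k m (instr q) := by
  unfold Acc
  cases h : instr q with
  | push j a q' =>
    refine (Machine.acceptsWithin_push (M := guesser) h).trans ?_
    exact iff_of_eq (congrArg (fun s => guesser.AcceptsWithin O k ⟨q', s⟩) (m.update_get _ _))
  | pop j f =>
    refine (Machine.acceptsWithin_pop (M := guesser) h).trans ?_
    exact iff_of_eq (congrArg (fun s => guesser.AcceptsWithin O k ⟨_, s⟩) (m.update_get _ _))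
  | guess q₁ q₂ => exact Machine.acceptsWithin_guess (M := guesser) h
  | query q₁ q₂ =>
    refine (Machine.acceptsWithin_query (M := guesser) h).trans ?_
    exact iff_of_eq (congrArg (fun s => (O m.q ∧ guesser.AcceptsWithin O k ⟨q₁, s⟩) ∨
      (¬ O m.q ∧ guesser.AcceptsWithin O k ⟨q₂, s⟩)) (m.update_get .q []))
  | accept => exact iff_of_true (Machine.acceptsWithin_of_accept (M := guesser) h) trivial
  | reject => exact iff_of_false (Machine.not_acceptsWithin_of_reject (M := guesser) h) id

theorem Acc.mono {k' : ℕ} {q : St} {m : Mem} (h : Acc O k q m) (hk : k ≤ k') : Acc O k' q m :=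
  Machine.AcceptsWithin.mono h hk

theorem not_acc_zero {q : St} {m : Mem} (h : instr q ≠ .accept) : ¬ Acc O 0 q m :=
  Machine.not_acceptsWithin_zero (M := guesser) h

theorem not_acc_rej {m : Mem} : ¬ Acc O k .rej m :=
  Machine.not_acceptsWithin_of_reject (M := guesser) rfl

theorem acc_acc {m : Mem} : Acc O k .acc m :=
  Machine.acceptsWithin_of_accept (M := guesser) rfl

variable (i g q z tb tf lb lf : List Sym)

theorem acc_move_goal : Acc O (k + 2 * g.length + 1) (.move .goal) ⟨i, g, q, z, tb, tf, lb, lf⟩ ↔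
    Acc O k (.selStart .goal) ⟨i, [], g.reverse ++ q, z, tb, tf, lb, lf⟩ := by
  have := Machine.acceptsWithin_move (M := guesser) (O := O) (q := .move .goal) (j₁ := .goal)
    (j₂ := .q) (r := .movePush .goal) (fun h => Stk.noConfusion h) rfl (fun _ => rfl) (k := k)
    (Mem.get ⟨i, g, q, z, tb, tf, lb, lf⟩)
  refine this.trans (iff_of_eq (congrArg (fun s => guesser.AcceptsWithin O k ⟨_, s⟩) ?_))
  funext y
  cases y <;> rfl

theorem acc_move_thy : Acc O (k + 2 * tf.length + 1) (.move .thy) ⟨i, g, q, z, tb, tf, lb, lf⟩ ↔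
    Acc O k (.new .thy) ⟨i, g, q, z, tf.reverse ++ tb, [], lb, lf⟩ := by
  have := Machine.acceptsWithin_move (M := guesser) (O := O) (q := .move .thy) (j₁ := .tf)
    (j₂ := .tb) (r := .movePush .thy) (fun h => Stk.noConfusion h) rfl (fun _ => rfl) (k := k)
    (Mem.get ⟨i, g, q, z, tb, tf, lb, lf⟩)
  refine this.trans (iff_of_eq (congrArg (fun s => guesser.AcceptsWithin O k ⟨_, s⟩) ?_))
  funext y
  cases y <;> rfl

theorem acc_move_edge : Acc O (k + 2 * lf.length + 1) (.move .edge) ⟨i, g, q, z, tb, tf, lb, lf⟩ ↔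
    Acc O k .main ⟨i, g, q, z, tb, tf, lf.reverse ++ lb, []⟩ := by
  have := Machine.acceptsWithin_move (M := guesser) (O := O) (q := .move .edge) (j₁ := .lf)
    (j₂ := .lb) (r := .movePush .edge) (fun h => Stk.noConfusion h) rfl (fun _ => rfl) (k := k)
    (Mem.get ⟨i, g, q, z, tb, tf, lb, lf⟩)
  refine this.trans (iff_of_eq (congrArg (fun s => guesser.AcceptsWithin O k ⟨_, s⟩) ?_))
  funext y
  cases y <;> rfl

/-! ### Unique decoding of delimited words -/

/-- The words of a list, each followed by a separator. -/
def delimited (ws : List (List Bool)) : List Sym := ws.flatMap fun w => word w ++ [Sym.sep]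

theorem delimited_cons (w : List Bool) (ws : List (List Bool)) :
    delimited (w :: ws) = word w ++ Sym.sep :: delimited ws := by
  simp [delimited]

theorem reverse_delimited_concat (ws : List (List Bool)) (w : List Bool) :
    (delimited (ws ++ [w])).reverse = Sym.sep :: ((word w).reverse ++ (delimited ws).reverse) := by
  simp [delimited]

theorem word_append_sep_inj {w w' : List Bool} {x x' : List Sym}
    (h : word w ++ Sym.sep :: x = word w' ++ Sym.sep :: x') : w = w' ∧ x = x' := by
  induction w generalizing w' with
  | nil => cases w' <;> simp_all [word]
  | cons b w ih =>
    cases w' with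
    | nil => simp [word] at h
    | cons b' w' =>
      simp only [word, List.map_cons, List.cons_append, List.cons.injEq, Sym.bit.injEq] at h
      obtain ⟨rfl, h⟩ := h
      obtain ⟨rfl, rfl⟩ := ih h
      exact ⟨rfl, rfl⟩

theorem sep_notMem_word (w : List Bool) : Sym.sep ∉ word w := by
  simp [word]

theorem word_injective : Function.Injective word :=
  List.map_injective_iff.2 fun _ _ h => Sym.bit.inj h

/-- Words contain no separator, so the first separator determines the first word. -/
theorem delimited_append_word_inj {ws ws' : List (List Bool)} {w w' : List Bool}
    (h : delimited ws ++ word w = delimited ws' ++ word w') : ws = ws' ∧ w = w' := by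
  induction ws generalizing ws' with
  | nil =>
    cases ws' with
    | nil => exact ⟨rfl, word_injective (by simpa [delimited] using h)⟩
    | cons v ws' =>
      refine absurd ?_ (sep_notMem_word w)
      have h' : word w = word v ++ Sym.sep :: delimited ws' ++ word w' := by
        simpa [delimited] using h
      rw [h']
      simp
  | cons v ws ih =>
    cases ws' with
    | nil =>
      refine absurd ?_ (sep_notMem_word w')
      have h' : word v ++ Sym.sep :: delimited ws ++ word w = word w' := by
        simpa [delimited] using h
      rw [← h']
      simp
    | cons v' ws' =>
      rw [delimited_cons, delimited_cons, List.append_assoc, List.append_assoc, List.cons_append,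
        List.cons_append] at h
      obtain ⟨rfl, h'⟩ := word_append_sep_inj h
      obtain ⟨rfl, rfl⟩ := ih h'
      exact ⟨rfl, rfl⟩

theorem word_cons (b : Bool) (w : List Bool) : word (b :: w) = .bit b :: word w := rfl

theorem reverse_word (w : List Bool) : (word w).reverse = word w.reverse := by
  simp [word]

theorem length_word (w : List Bool) : (word w).length = w.length := by
  simp [word]

/-! ### Parsing the input -/

theorem acc_parseWord_word (w : List Bool) :
    Acc O (k + 2 * w.length) .parseWord ⟨word w ++ i, g, q, z, tb, tf, lb, lf⟩ ↔
      Acc O k .parseWord ⟨i, g, q, z, (word w).reverse ++ tb, tf, lb, lf⟩ := by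
  induction w generalizing tb with
  | nil => rfl
  | cons b w ih =>
    simp only [List.length_cons, Nat.mul_succ, ← Nat.add_assoc, word_cons, List.cons_append,
      List.reverse_cons, List.append_assoc, List.nil_append]
    rw [acc_succ]
    refine (acc_succ (q := .parsePush b)).trans (ih _)

theorem acc_parse_delimited (ws : List (List Bool)) (hws : ∀ w ∈ ws, w ≠ []) :
    Acc O (k + 2 * (delimited ws).length) .parse ⟨delimited ws ++ i, g, q, z, tb, tf, lb, lf⟩ ↔
      Acc O k .parse ⟨i, g, q, z, (delimited ws).reverse ++ tb, tf, lb, lf⟩ := by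
  induction ws generalizing tb with
  | nil => rfl
  | cons w ws ih =>
    obtain ⟨b, w, rfl⟩ := List.exists_cons_of_ne_nil (hws w List.mem_cons_self)
    have hlen : k + 2 * (delimited ((b :: w) :: ws)).length =
        k + 2 * (delimited ws).length + 1 + 1 + 2 * w.length + 1 + 1 := by
      simp [delimited_cons, length_word]
      ring
    rw [hlen, delimited_cons, word_cons, List.cons_append, List.cons_append, List.append_assoc,
      acc_succ]
    refine (acc_succ (q := .parsePush b)).trans ?_
    refine (acc_parseWord_word _ _ _ _ _ _ _ _ _).trans ?_
    rw [List.cons_append, acc_succ]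
    refine (acc_succ (q := .parseSep)).trans ?_
    refine (ih _ fun w hw => hws w (List.mem_cons_of_mem _ hw)).trans ?_
    simp [Mem.get, Mem.set]

theorem acc_parseGoal_word (w : List Bool) :
    Acc O (k + 2 * w.length) .parseGoal ⟨word w ++ i, g, q, z, tb, tf, lb, lf⟩ ↔
      Acc O k .parseGoal ⟨i, (word w).reverse ++ g, q, z, tb, tf, lb, lf⟩ := by
  induction w generalizing g with
  | nil => rfl
  | cons b w ih =>
    simp only [List.length_cons, Nat.mul_succ, ← Nat.add_assoc, word_cons, List.cons_append,
      List.reverse_cons, List.append_assoc, List.nil_append]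
    rw [acc_succ]
    refine (acc_succ (q := .parseGoalPush b)).trans (ih _)

/-- The first phase of `guesser` distributes the input over the stacks. -/
theorem acc_parse (ws : List (List Bool)) (hws : ∀ w ∈ ws, w ≠ []) (w : List Bool) :
    Acc O (k + 2 * (delimited ws).length + 2 * w.length + 2) .parse
        ⟨delimited ws ++ (.sep :: (word w ++ .sep :: i)), [], [], [], [], [], [], []⟩ ↔
      Acc O k .main ⟨i, (word w).reverse, [], [], (delimited ws).reverse, [], [], []⟩ := by
  have hlen : k + 2 * (delimited ws).length + 2 * w.length + 2 =
      k + 1 + 2 * w.length + 1 + 2 * (delimited ws).length := by ring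
  rw [hlen, acc_parse_delimited _ _ _ _ _ _ _ _ _ hws, acc_succ]
  refine (acc_parseGoal_word _ _ _ _ _ _ _ _ _).trans ?_
  rw [acc_succ, List.append_nil, List.append_nil]
  rfl

/-! ### Decrementing the counter -/

theorem acc_decBack (j : ℕ) :
    Acc O (k + 2 * j + 1) .decBack ⟨i, g, q, .replicate j (.bit false), tb, tf, lb, lf⟩ ↔
      Acc O k .choose ⟨.replicate j (.bit true) ++ i, g, q, [], tb, tf, lb, lf⟩ := by
  induction j generalizing i with
  | zero =>
    rw [acc_succ]
    rfl
  | succ j ih =>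
    rw [Nat.mul_succ, ← Nat.add_assoc, acc_succ, List.replicate_succ]
    refine (acc_succ (q := .decBackPush)).trans ((ih _).trans ?_)
    rw [List.replicate_succ']
    simp [Mem.get, Mem.set]

/-- The decrementing loop, on a positive number. -/
theorem acc_dec (j j' : ℕ) :
    Acc O (k + 2 * (j + j') + 1 + 1 + 1 + 2 * j) .dec
        ⟨.replicate j (.bit false) ++ .bit true :: i, g, q, .replicate j' (.bit false),
          tb, tf, lb, lf⟩ ↔
      Acc O k .choose
        ⟨.replicate (j + j') (.bit true) ++ .bit false :: i, g, q, [], tb, tf, lb, lf⟩ := by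
  induction j generalizing j' with
  | zero =>
    simp only [Nat.zero_add, Nat.mul_zero, Nat.add_zero, List.replicate_zero, List.nil_append]
    rw [acc_succ]
    refine (acc_succ (q := .decOne)).trans ?_
    exact acc_decBack _ _ _ _ _ _ _ _
  | succ j ih =>
    rw [Nat.mul_succ, ← Nat.add_assoc, acc_succ, List.replicate_succ]
    refine (acc_succ (q := .decZero)).trans ?_
    have hj : j + 1 + j' = j + (j' + 1) := by ring
    rw [hj]
    exact ih (j' + 1)

/-- The decrementing loop, on zero. -/
theorem not_acc_dec (j : ℕ) :
    ¬ Acc O k .dec ⟨.replicate j (.bit false), g, q, z, tb, tf, lb, lf⟩ := by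
  induction j generalizing z with
  | zero =>
    intro h
    exact not_acc_rej ((acc_succ (q := .dec)).1 (h.mono (Nat.le_succ _)))
  | succ j ih =>
    intro h
    have h := (acc_succ (q := .dec)).1 (h.mono (Nat.le_succ (k + 1) |>.trans' (Nat.le_succ k)))
    exact ih _ ((acc_succ (q := .decZero)).1 h)

/-! ### Choosing a sentence of the theory -/

theorem acc_skip_word (w : List Bool) :
    Acc O (k + 2 * w.length) .skip ⟨i, g, q, z, word w ++ tb, tf, lb, lf⟩ ↔
      Acc O k .skip ⟨i, g, q, z, tb, (word w).reverse ++ tf, lb, lf⟩ := by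
  induction w generalizing tf with
  | nil => rfl
  | cons b w ih =>
    simp only [List.length_cons, Nat.mul_succ, ← Nat.add_assoc, word_cons, List.cons_append,
      List.reverse_cons, List.append_assoc, List.nil_append]
    rw [acc_succ]
    refine (acc_succ (q := .skipPush b)).trans (ih _)

theorem acc_copy_word (w : List Bool) :
    Acc O (k + 3 * w.length) .copy ⟨i, g, q, z, word w ++ tb, tf, lb, lf⟩ ↔
      Acc O k .copy ⟨i, g, (word w).reverse ++ q, z, tb, (word w).reverse ++ tf, lb, lf⟩ := by
  induction w generalizing q tf with
  | nil => rfl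
  | cons b w ih =>
    simp only [List.length_cons, Nat.mul_succ, ← Nat.add_assoc, word_cons, List.cons_append,
      List.reverse_cons, List.append_assoc, List.nil_append]
    rw [acc_succ]
    refine (acc_succ (q := .copyPush b)).trans ?_
    refine (acc_succ (q := .copyPushQ b)).trans (ih _ _)

theorem acc_pickEnd :
    Acc O (k + 2 * tf.length + 1 + 1) .pickEnd ⟨i, g, q, z, tb, tf, lb, lf⟩ ↔
      Acc O k (.new .thy) ⟨i, g, .sep :: q, z, tf.reverse ++ tb, [], lb, lf⟩ := by
  rw [acc_succ]
  exact acc_move_thy _ _ _ _ _ _ _ _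

/-- The copied word ends at a separator or at the bottom of the stack. The two cases differ in cost,
whence the existential `j`, which does not depend on the budget. -/
theorem acc_copy_end (ws : List (List Bool)) :
    ∃ j ≤ 2 * tf.length + 6, ∀ k,
      Acc O (k + j) .copy ⟨i, g, q, z, (delimited ws).reverse, tf, lb, lf⟩ ↔
      Acc O k (.new .thy)
        ⟨i, g, .sep :: q, z, tf.reverse ++ (delimited ws).reverse, [], lb, lf⟩ := by
  rcases List.eq_nil_or_concat' ws with rfl | ⟨ws, w, rfl⟩
  · refine ⟨2 * tf.length + 1 + 1 + 1, by omega, fun k => ?_⟩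
    refine (acc_succ (q := .copy)).trans ?_
    exact acc_pickEnd _ _ _ _ _ _ _ _
  · refine ⟨2 * (tf.length + 1) + 1 + 1 + 1 + 1, by omega, fun k => ?_⟩
    rw [reverse_delimited_concat]
    change Acc O (k + 2 * (tf.length + 1) + 1 + 1 + 1 + 1) _ _ ↔ _
    refine (acc_succ (q := .copy)).trans ?_
    refine (acc_succ (q := .copySep)).trans ?_
    refine (acc_pickEnd i g q z ((word w).reverse ++ (delimited ws).reverse) (.sep :: tf)
      lb lf).trans ?_
    simp

/-- Sentences are met from last to first, and each separator offers the choice to copy the next word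
or to go on. The budget is not lowered, since soundness needs no time count. -/
theorem acc_skip_sound (ws : List (List Bool))
    (h : Acc O k .skip ⟨i, g, q, z, (delimited ws).reverse, tf, lb, lf⟩) :
    ∃ w ∈ ws, Acc O k (.new .thy)
      ⟨i, g, .sep :: (word w ++ q), z, tf.reverse ++ (delimited ws).reverse, [], lb, lf⟩ := by
  induction ws using List.reverseRecOn generalizing tf with
  | nil => exact (not_acc_rej ((acc_succ (q := .skip)).1 (h.mono (Nat.le_succ _)))).elim
  | append_singleton ws w ih =>
    rw [reverse_delimited_concat, reverse_word] at h
    have h := (acc_succ (q := .skip)).1 (h.mono (show k ≤ k + 1 + 1 + 1 by omega))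
    have h := (acc_succ (q := .skipSep)).1 h
    rcases (acc_succ (q := .skipGuess)).1 h with h | h
    · have h := (acc_skip_word _ _ _ _ _ _ _ _ _).1 (h.mono (Nat.le_add_right _ _))
      obtain ⟨v, hv, h⟩ := ih _ h
      refine ⟨v, List.mem_append_left _ hv, ?_⟩
      rw [reverse_delimited_concat]
      simpa [Mem.get, Mem.set, reverse_word] using h
    · have h := (acc_copy_word _ _ _ _ _ _ _ _ _).1 (h.mono (Nat.le_add_right _ _))
      obtain ⟨j, -, hj⟩ := acc_copy_end (O := O) i g ((word w.reverse).reverse ++ q) z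
        ((word w.reverse).reverse ++ .sep :: tf) lb lf ws
      have h := (hj k).1 (h.mono (Nat.le_add_right _ _))
      refine ⟨w, List.mem_append_right _ List.mem_cons_self, ?_⟩
      rw [reverse_delimited_concat]
      simpa [reverse_word] using h

/-- Including the way back from `tf`, a skipped word of length `n` costs `4 * n + 5` steps, and the
copied one at most `5 * n + 11` besides `2 * tf.length`; this explains the constants 7 and 10. -/
theorem acc_skip_complete {ws : List (List Bool)} {w : List Bool} (hw : w ∈ ws)
    (h : Acc O k (.new .thy)
      ⟨i, g, .sep :: (word w ++ q), z, tf.reverse ++ (delimited ws).reverse, [], lb, lf⟩) :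
    Acc O (k + 7 * (delimited ws).length + 2 * tf.length + 10) .skip
      ⟨i, g, q, z, (delimited ws).reverse, tf, lb, lf⟩ := by
  induction ws using List.reverseRecOn generalizing tf with
  | nil => simp at hw
  | append_singleton ws v ih =>
    have hlen : (delimited (ws ++ [v])).length = (delimited ws).length + v.length + 1 := by
      simp [delimited, length_word, Nat.add_assoc]
    rw [hlen]
    rw [reverse_delimited_concat] at h ⊢
    rw [reverse_word] at h ⊢
    rcases List.mem_append.1 hw with hw | hw
    · have h := ih ((word v.reverse).reverse ++ .sep :: tf) hw (by simpa using h)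
      have h := (acc_skip_word _ _ _ _ _ _ _ _ _).2 h
      have h := (acc_succ (q := .skipGuess)).2 (.inl h)
      have h := (acc_succ (q := .skipSep) (m := ⟨i, g, q, z, _, tf, lb, lf⟩)).2 h
      have h := (acc_succ (q := .skip) (m := ⟨i, g, q, z, .sep :: _, tf, lb, lf⟩)).2 h
      refine h.mono ?_
      simp [length_word]
      omega
    · obtain rfl : w = v := by simpa using hw
      obtain ⟨j, hj', hj⟩ := acc_copy_end (O := O) i g ((word w.reverse).reverse ++ q) z
        ((word w.reverse).reverse ++ .sep :: tf) lb lf ws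
      have h := (hj k).2 (by simpa [reverse_word] using h)
      have h := (acc_copy_word _ _ _ _ _ _ _ _ _).2 h
      have h := (acc_succ (q := .skipGuess)).2 (.inr h)
      have h := (acc_succ (q := .skipSep) (m := ⟨i, g, q, z, _, tf, lb, lf⟩)).2 h
      have h := (acc_succ (q := .skip) (m := ⟨i, g, q, z, .sep :: _, tf, lb, lf⟩)).2 h
      refine h.mono ?_
      simp [length_word] at hj' ⊢
      omega

/-! ### Guessing a vertex and selecting earlier ones -/

variable (m : Mode)

theorem acc_newGuess_sound (h : Acc O k (.newGuess m) ⟨i, g, q, z, tb, tf, lb, lf⟩) :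
    ∃ w, Acc O k (.selStart m) ⟨i, g, word w ++ q, z, tb, tf, lb, word w ++ lf⟩ := by
  -- Only the first step of each round lowers the budget; the others are refunded by monotonicity.
  induction k using Nat.strong_induction_on generalizing q lf with
  | _ k ih =>
    match k with
    | 0 => exact absurd h (not_acc_zero (by simp [instr]))
    | k + 1 =>
      rcases (acc_succ (q := .newGuess m)).1 h with h | h
      · exact ⟨[], h.mono (Nat.le_succ _)⟩
      · obtain ⟨b, h⟩ : ∃ b, Acc O k (.newPush m b) ⟨i, g, q, z, tb, tf, lb, lf⟩ := by
          rcases (acc_succ (q := .newBit m)).1 (h.mono (Nat.le_succ _)) with h | h <;> exact ⟨_, h⟩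
        have h := (acc_succ (q := .newPush m b)).1 (h.mono (show k ≤ k + 1 + 1 by omega))
        have h := (acc_succ (q := .newPushQ m b)).1 h
        obtain ⟨w, h⟩ := ih k (Nat.lt_succ_self k) _ _ h
        refine ⟨w ++ [b], ?_⟩
        simpa [word, Mem.get, Mem.set] using h.mono (Nat.le_succ k)

theorem acc_newGuess_complete (w : List Bool)
    (h : Acc O k (.selStart m) ⟨i, g, word w ++ q, z, tb, tf, lb, word w ++ lf⟩) :
    Acc O (k + 4 * w.length + 1) (.newGuess m) ⟨i, g, q, z, tb, tf, lb, lf⟩ := by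
  have key : ∀ (w : List Bool) (k : ℕ),
      Acc O k (.newGuess m) ⟨i, g, word w ++ q, z, tb, tf, lb, word w ++ lf⟩ →
      Acc O (k + 4 * w.length) (.newGuess m) ⟨i, g, q, z, tb, tf, lb, lf⟩ := by
    intro w
    induction w with
    | nil => exact fun k h => h
    | cons b w ih =>
      intro k h
      have h := (acc_succ (q := .newPushQ m b)
        (m := ⟨i, g, word w ++ q, z, tb, tf, lb, .bit b :: (word w ++ lf)⟩)).2 h
      have h := (acc_succ (q := .newPush m b)
        (m := ⟨i, g, word w ++ q, z, tb, tf, lb, word w ++ lf⟩)).2 h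
      have h := (acc_succ (q := .newBit m)).2 (by cases b; exacts [.inl h, .inr h])
      have h := (acc_succ (q := .newGuess m)).2 (.inr h)
      refine (ih _ h).mono ?_
      rw [List.length_cons]
      omega
  refine (key w (k + 1) ((acc_succ (q := .newGuess m)).2 (.inl h))).mono ?_
  omega

theorem acc_sel_false_word (w : List Bool) :
    Acc O (k + 2 * w.length) (.sel m false) ⟨i, g, q, z, tb, tf, word w ++ lb, lf⟩ ↔
      Acc O k (.sel m false) ⟨i, g, q, z, tb, tf, lb, (word w).reverse ++ lf⟩ := by
  induction w generalizing lf with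
  | nil => rfl
  | cons b w ih =>
    simp only [List.length_cons, Nat.mul_succ, ← Nat.add_assoc, word_cons, List.cons_append,
      List.reverse_cons, List.append_assoc, List.nil_append]
    rw [acc_succ]
    refine (acc_succ (q := .selPush m false b)).trans (ih _)

theorem acc_sel_true_word (w : List Bool) :
    Acc O (k + 3 * w.length) (.sel m true) ⟨i, g, q, z, tb, tf, word w ++ lb, lf⟩ ↔
      Acc O k (.sel m true)
        ⟨i, g, (word w).reverse ++ q, z, tb, tf, lb, (word w).reverse ++ lf⟩ := by
  induction w generalizing q lf with
  | nil => rfl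
  | cons b w ih =>
    simp only [List.length_cons, Nat.mul_succ, ← Nat.add_assoc, word_cons, List.cons_append,
      List.reverse_cons, List.append_assoc, List.nil_append]
    rw [acc_succ]
    refine (acc_succ (q := .selPush m true b)).trans ?_
    refine (acc_succ (q := .selPushQ m b)).trans (ih _ _)

theorem acc_sel_sound (ws : List (List Bool)) (c : Bool)
    (h : Acc O k (.sel m c) ⟨i, g, q, z, tb, tf, (delimited ws).reverse, lf⟩) :
    ∃ vs, vs ⊆ ws ∧ Acc O k (.ask m)
      ⟨i, g, delimited vs ++ q, z, tb, tf, [], delimited ws ++ lf⟩ := by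
  induction ws using List.reverseRecOn generalizing c q lf with
  | nil => exact ⟨[], List.Subset.refl _, (acc_succ (q := .sel m c)).1 (h.mono (Nat.le_succ _))⟩
  | append_singleton ws w ih =>
    rw [reverse_delimited_concat, reverse_word] at h
    have h := (acc_succ (q := .sel m c)).1 (h.mono (show k ≤ k + 1 + 1 + 1 by omega))
    have h := (acc_succ (q := .selSep m)).1 h
    rcases (acc_succ (q := .selGuess m)).1 h with h | h
    · have h := (acc_sel_false_word _ _ _ _ _ _ _ _ _ _).1 (h.mono (Nat.le_add_right _ _))
      obtain ⟨vs, hvs, h⟩ := ih _ _ _ h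
      refine ⟨vs, fun _ hx => List.mem_append_left _ (hvs hx), ?_⟩
      simpa [Mem.get, Mem.set, reverse_word, delimited] using h
    · have h := (acc_succ (q := .selSepQ m)).1 (h.mono (Nat.le_succ _))
      have h := (acc_sel_true_word _ _ _ _ _ _ _ _ _ _).1 (h.mono (Nat.le_add_right _ _))
      obtain ⟨vs, hvs, h⟩ := ih _ _ _ h
      refine ⟨vs ++ [w], List.append_subset.2 ⟨fun _ hx => List.mem_append_left _ (hvs hx),
        List.subset_append_right _ _⟩, ?_⟩
      simpa [Mem.get, Mem.set, reverse_word, delimited] using h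

/-- The predicate `p` resolves the guesses. It is constantly false for theory sentences, membership
in the source set for hyperedges, and equality with the concluding vertex for the goal. -/
theorem acc_sel_complete (ws : List (List Bool)) (p : List Bool → Bool) (c : Bool)
    (h : Acc O k (.ask m)
      ⟨i, g, delimited (ws.filter p) ++ q, z, tb, tf, [], delimited ws ++ lf⟩) :
    Acc O (k + 4 * (delimited ws).length + 1) (.sel m c)
      ⟨i, g, q, z, tb, tf, (delimited ws).reverse, lf⟩ := by
  induction ws using List.reverseRecOn generalizing c q lf with
  | nil => exact (acc_succ (q := .sel m c)).2 h
  | append_singleton ws w ih =>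
    have hlen : (delimited (ws ++ [w])).length = (delimited ws).length + w.length + 1 := by
      simp [delimited, length_word, Nat.add_assoc]
    rw [hlen, reverse_delimited_concat, reverse_word]
    cases hp : p w
    · have h := ih q ((word w.reverse).reverse ++ .sep :: lf) false
        (by simpa [reverse_word, delimited, hp] using h)
      have h := (acc_sel_false_word _ _ _ _ _ _ _ _ _ _).2 h
      have h := (acc_succ (q := .selGuess m)).2 (.inl h)
      have h := (acc_succ (q := .selSep m) (m := ⟨i, g, q, z, tb, tf, _, lf⟩)).2 h
      have h := (acc_succ (q := .sel m c) (m := ⟨i, g, q, z, tb, tf, .sep :: _, lf⟩)).2 h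
      refine h.mono ?_
      rw [List.length_reverse]
      omega
    · have h := ih ((word w.reverse).reverse ++ .sep :: q)
        ((word w.reverse).reverse ++ .sep :: lf) true
        (by simpa [reverse_word, delimited, hp] using h)
      have h := (acc_sel_true_word _ _ _ _ _ _ _ _ _ _).2 h
      have h := (acc_succ (q := .selSepQ m) (m := ⟨i, g, q, z, tb, tf, _, _⟩)).2 h
      have h := (acc_succ (q := .selGuess m)).2 (.inr h)
      have h := (acc_succ (q := .selSep m) (m := ⟨i, g, q, z, tb, tf, _, lf⟩)).2 h
      have h := (acc_succ (q := .sel m c) (m := ⟨i, g, q, z, tb, tf, .sep :: _, lf⟩)).2 h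
      refine h.mono ?_
      rw [List.length_reverse]
      omega

end Program

/-! ### Binary digits with leading zeros -/

/-- The number with the given binary digits, least significant digit first. -/
def bval : List Bool → ℕ
  | [] => 0
  | b :: w => b.toNat + 2 * bval w

theorem bval_bits (n : ℕ) : bval n.bits = n := by
  induction n using Nat.binaryRec' with
  | zero => simp [bval]
  | bit b n h ih =>
    rw [Nat.bits_append_bit n b h, bval, ih, Nat.bit_val]
    ring

theorem bits_injective : Function.Injective Nat.bits :=
  Function.LeftInverse.injective bval_bits

/-- Borrowing preserves the number of digits, so leading zeros may arise; this is why the counter is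
measured by `bval` and not compared with `Nat.bits`. -/
theorem bval_decrement (j : ℕ) (w : List Bool) :
    bval (.replicate j true ++ false :: w) + 1 = bval (.replicate j false ++ true :: w) := by
  induction j with
  | zero => simp [bval, Nat.add_comm]
  | succ j ih =>
    simp only [List.replicate_succ, List.cons_append, bval, Bool.toNat_true, Bool.toNat_false]
    omega

theorem bval_replicate_false (j : ℕ) : bval (.replicate j false) = 0 := by
  induction j with
  | zero => rfl
  | succ j ih => simp [List.replicate_succ, bval, ih]

theorem eq_replicate_false_or (w : List Bool) :
    (∃ j, w = .replicate j false) ∨ ∃ j w', w = .replicate j false ++ true :: w' := by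
  induction w with
  | nil => exact .inl ⟨0, rfl⟩
  | cons b w ih =>
    cases b
    · rcases ih with ⟨j, rfl⟩ | ⟨j, w', rfl⟩
      · exact .inl ⟨j + 1, rfl⟩
      · exact .inr ⟨j + 1, w', rfl⟩
    · exact .inr ⟨0, w, rfl⟩

/-! ### Decoding oracle queries -/

section Oracle

variable {L : Logic.{u, v}} (H : Hypergraph L)

theorem edgeQuery_eq (vs : List ℕ) (d : ℕ) :
    edgeQuery vs d = .bit false :: (delimited (vs.map Nat.bits) ++ word d.bits) := by
  simp [edgeQuery, delimited, binary, List.flatMap_map]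

theorem labelQuery_eq (w : ℕ) (α : L.Sentence) :
    labelQuery w α = .bit true :: (delimited [w.bits] ++ word (L.code α)) := by
  simp [labelQuery, delimited, binary]

/-- The leading bit separates the two kinds of queries. A positive answer forces guessed addresses
to be canonical binary words. -/
theorem oracle_edge (ws : List (List Bool)) (w : List Bool) :
    H.oracle (.bit false :: (delimited ws ++ word w)) ↔
      ∃ (vs : List ℕ) (d : ℕ), ws = vs.map Nat.bits ∧ w = d.bits ∧ (vs.toFinset, d) ∈ H.E := by
  simp only [Hypergraph.oracle, edgeQuery_eq, labelQuery_eq]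
  constructor
  · rintro (⟨vs, d, h, hE⟩ | ⟨v, -, h⟩)
    · obtain ⟨h1, h2⟩ := delimited_append_word_inj (List.cons.inj h).2
      exact ⟨vs, d, h1, h2, hE⟩
    · simp at h
  · rintro ⟨vs, d, rfl, rfl, hE⟩
    exact .inl ⟨vs, d, rfl, hE⟩

theorem oracle_label (ws : List (List Bool)) (a : List Bool) :
    H.oracle (.bit true :: (delimited ws ++ word a)) ↔
      ∃ w ∈ H.V, ws = [w.bits] ∧ a = L.code (H.label w) := by
  simp only [Hypergraph.oracle, edgeQuery_eq, labelQuery_eq]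
  constructor
  · rintro (⟨vs, d, h, -⟩ | ⟨w, hw, h⟩)
    · simp at h
    · obtain ⟨h1, h2⟩ := delimited_append_word_inj (List.cons.inj h).2
      exact ⟨w, hw, h1, h2⟩
  · rintro ⟨w, hw, rfl, rfl⟩
    exact .inr ⟨w, hw, rfl⟩

end Oracle

/-! ### The phases of one round -/

section Phases

variable {O : List Sym → Prop} {k : ℕ} (i g q z tb tf lb lf : List Sym)

theorem word_append (w w' : List Bool) : word (w ++ w') = word w ++ word w' := by
  simp [word]

theorem word_replicate (j : ℕ) (b : Bool) : word (.replicate j b) = .replicate j (.bit b) := by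
  simp [word]

theorem acc_dec_sound {c : List Bool}
    (h : Acc O k .dec ⟨word c, g, q, [], tb, tf, lb, lf⟩) :
    ∃ c', bval c' + 1 = bval c ∧ Acc O k .choose ⟨word c', g, q, [], tb, tf, lb, lf⟩ := by
  rcases eq_replicate_false_or c with ⟨j, rfl⟩ | ⟨j, w, rfl⟩
  · rw [word_replicate] at h
    exact absurd h (not_acc_dec _ _ _ _ _ _ _ _)
  · refine ⟨_, bval_decrement j w, ?_⟩
    rw [word_append, word_replicate, word_cons] at h ⊢
    have := (acc_dec (word w) g q tb tf lb lf j 0).1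
      (h.mono (k' := k + 2 * (j + 0) + 1 + 1 + 1 + 2 * j) (by omega))
    exact this

theorem acc_dec_complete {c : List Bool} (hc : 0 < bval c) :
    ∃ c', c'.length = c.length ∧ bval c' + 1 = bval c ∧ ∀ k,
      Acc O k .choose ⟨word c', g, q, [], tb, tf, lb, lf⟩ →
      Acc O (k + 4 * c.length + 3) .dec ⟨word c, g, q, [], tb, tf, lb, lf⟩ := by
  rcases eq_replicate_false_or c with ⟨j, rfl⟩ | ⟨j, w, rfl⟩
  · rw [bval_replicate_false] at hc
    omega
  · refine ⟨_, ?_, bval_decrement j w, fun k h => ?_⟩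
    · simp
    rw [word_append, word_replicate, word_cons] at h ⊢
    have := (acc_dec (word w) g q tb tf lb lf j 0).2 h
    refine this.mono ?_
    simp
    omega

variable (m : Mode)

theorem acc_ask (hm : m ≠ .goal) : Acc O (k + 1 + 1) (.ask m) ⟨i, g, q, z, tb, tf, lb, lf⟩ ↔
    O (.bit m.label :: q) ∧
      Acc O k (.move .edge) ⟨i, g, [], z, tb, tf, lb, lf⟩ := by
  refine (acc_succ (q := .ask m)).trans ((acc_succ (q := .query m)).trans ?_)
  cases m with
  | goal => exact absurd rfl hm
  | thy => exact or_iff_left fun h => not_acc_rej h.2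
  | edge => exact or_iff_left fun h => not_acc_rej h.2

theorem acc_ask_goal : Acc O (k + 1 + 1) (.ask .goal) ⟨i, g, q, z, tb, tf, lb, lf⟩ ↔
    O (.bit true :: q) := by
  refine (acc_succ (q := .ask .goal)).trans ((acc_succ (q := .query .goal)).trans ?_)
  exact (or_iff_left fun h => not_acc_rej h.2).trans (and_iff_left acc_acc)

/-- One routine serves both checks: `q` holds a separator and a theory sentence for a label query,
and is empty for a hyperedge query. -/
theorem acc_new_sound (ws : List (List Bool)) (hm : m ≠ .goal)
    (h : Acc O k (.new m) ⟨i, g, q, z, tb, tf, (delimited ws).reverse, []⟩) :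
    ∃ w vs, vs ⊆ ws ∧
      O (.bit m.label :: (delimited vs ++ (word w ++ q))) ∧
      Acc O k .main ⟨i, g, [], z, tb, tf, (delimited (ws ++ [w])).reverse, []⟩ := by
  have h := (acc_succ (q := .new m)).1 (h.mono (Nat.le_succ _))
  obtain ⟨w, h⟩ := acc_newGuess_sound _ _ _ _ _ _ _ _ _ h
  obtain ⟨c, h⟩ : ∃ c, Acc O k (.sel m c)
      ⟨i, g, word w ++ q, z, tb, tf, (delimited ws).reverse, word w ++ [.sep]⟩ := by
    rcases (acc_succ (q := .selStart m)).1 (h.mono (Nat.le_succ _)) with h | h <;> exact ⟨_, h⟩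
  obtain ⟨vs, hvs, h⟩ := acc_sel_sound _ _ _ _ _ _ _ _ _ _ h
  have h := (acc_ask _ _ _ _ _ _ _ _ m hm).1 (h.mono (Nat.le_add_right k 2))
  refine ⟨w, vs, hvs, h.1, ?_⟩
  have h := (acc_move_edge _ _ _ _ _ _ _ _).1
    (h.2.mono (Nat.le_add_right k (2 * (delimited ws ++ (word w ++ [Sym.sep])).length + 1)))
  simpa [delimited] using h

theorem acc_new_complete (ws : List (List Bool)) (w : List Bool) (p : List Bool → Bool)
    (hm : m ≠ .goal)
    (hO : O (.bit m.label ::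
      (delimited (ws.filter p) ++ (word w ++ q))))
    (h : Acc O k .main ⟨i, g, [], z, tb, tf, (delimited (ws ++ [w])).reverse, []⟩) :
    Acc O (k + 6 * (delimited ws).length + 6 * w.length + 10) (.new m)
      ⟨i, g, q, z, tb, tf, (delimited ws).reverse, []⟩ := by
  have h := (acc_move_edge i g [] z tb tf [] (delimited (ws ++ [w]))).2 (by simpa using h)
  have h := (acc_ask i g (delimited (ws.filter p) ++ (word w ++ q)) z tb tf [] _ m hm).2 ⟨hO, h⟩
  have h := acc_sel_complete (k := k + 2 * (delimited (ws ++ [w])).length + 1 + 1 + 1)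
    i g (word w ++ q) z tb tf (word w ++ [.sep]) m ws p false
    (by simpa [delimited] using h)
  have h := (acc_succ (q := .selStart m)).2 (.inl h)
  have h := acc_newGuess_complete _ _ _ _ _ _ _ _ _ _ h
  have h := (acc_succ (q := .new m) (m := ⟨i, g, q, z, tb, tf, (delimited ws).reverse, []⟩)).2 h
  refine h.mono ?_
  have hlen : (delimited (ws ++ [w])).length = (delimited ws).length + w.length + 1 := by
    simp [delimited, length_word, Nat.add_assoc]
  omega

end Phases

/-! ### The main loop -/

section Loop

variable {L : Logic.{u, v}} {H : Hypergraph L} {T : Finset L.Sentence} {xs : List L.Sentence}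
  {η : L.Sentence}

/-- The stacks at the start of the main loop, when the counter is `c` and the vertices in `l` have
been verified. -/
def mainMem (xs : List L.Sentence) (η : L.Sentence) (c : List Bool) (l : List ℕ) : Mem :=
  ⟨word c, (word (L.code η)).reverse, [], [], (delimited (xs.map L.code)).reverse, [],
    (delimited (l.map Nat.bits)).reverse, []⟩

theorem subset_map_bits {l vs : List ℕ} (h : vs.map Nat.bits ⊆ l.map Nat.bits) : vs ⊆ l := by
  intro u hu
  obtain ⟨w, hw, hwu⟩ := List.mem_map.1 (h (List.mem_map_of_mem hu))
  exact bits_injective hwu ▸ hw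

theorem acc_choose_sound {k : ℕ} {c : List Bool} {l : List ℕ} (hxs : ∀ α, α ∈ xs ↔ α ∈ T)
    (hl : H.ValidList T l) (h : Acc H.oracle k .choose (mainMem xs η c l)) :
    ∃ w, H.ValidList T (l ++ [w]) ∧ Acc H.oracle k .main (mainMem xs η c (l ++ [w])) := by
  rcases (acc_succ (q := .choose)).1 (h.mono (Nat.le_succ _)) with h | h
  · obtain ⟨a, ha, h⟩ := acc_skip_sound _ _ _ _ _ _ _ _ h
    obtain ⟨w, vs, -, hO, h⟩ := acc_new_sound _ _ _ _ _ _ _ _ (by simp) h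
    have hq : delimited vs ++ (word w ++ (Sym.sep :: (word a ++ []))) =
        delimited (vs ++ [w]) ++ word a := by
      simp [delimited]
    rw [hq] at hO
    obtain ⟨w', hw', hvs, rfl⟩ := (oracle_label H _ _).1 hO
    -- A label query carries exactly one address, so no earlier vertex was selected and the last
    -- word is that address.
    have hw : w = w'.bits := by
      have := congrArg List.getLast? hvs
      simpa using this
    subst hw
    obtain ⟨α, hα, hαw⟩ := List.mem_map.1 ha
    refine ⟨w', .snoc hl hw' (.inl ?_), ?_⟩
    · rw [← L.code_injective hαw, ← hxs]
      exact hα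
    · simpa [mainMem] using h
  · obtain ⟨w, vs, hvs, hO, h⟩ := acc_new_sound _ _ _ _ _ _ _ _ (by simp) h
    rw [List.append_nil] at hO
    obtain ⟨us, d, rfl, rfl, hE⟩ := (oracle_edge H _ _).1 hO
    refine ⟨d, .snoc hl (H.target_mem _ hE) (.inr ⟨_, hE, fun u hu => ?_⟩), ?_⟩
    · exact subset_map_bits hvs (List.mem_toFinset.1 hu)
    · simpa [mainMem] using h

/-- Each new vertex costs one unit of the counter, so `l.length + bval c` is invariant. -/
theorem acc_main_sound {k : ℕ} {c : List Bool} {l : List ℕ} (hxs : ∀ α, α ∈ xs ↔ α ∈ T)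
    (hl : H.ValidList T l) (h : Acc H.oracle k .main (mainMem xs η c l)) :
    ∃ l', H.ValidList T l' ∧ l'.length ≤ l.length + bval c ∧ ∃ w ∈ l', H.label w = η := by
  induction k generalizing c l with
  | zero => exact absurd h (not_acc_zero (by simp [instr]))
  | succ k ih =>
    rcases (acc_succ (q := .main)).1 h with h | h
    · have h := (acc_move_goal _ _ _ _ _ _ _ _).1
        (h.mono (Nat.le_add_right k (2 * (word (L.code η)).reverse.length + 1)))
      obtain ⟨b, h⟩ : ∃ b, Acc H.oracle k (.sel .goal b) _ := by
        rcases (acc_succ (q := .selStart .goal)).1 (h.mono (Nat.le_succ _)) with h | h <;>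
          exact ⟨_, h⟩
      obtain ⟨vs, hvs, h⟩ := acc_sel_sound _ _ _ _ _ _ _ _ _ _ h
      have hO := (acc_ask_goal _ _ _ _ _ _ _ _).1 (h.mono (Nat.le_add_right k 2))
      rw [List.reverse_reverse, List.append_nil, oracle_label] at hO
      obtain ⟨w, -, rfl, hw⟩ := hO
      refine ⟨l, hl, Nat.le_add_right _ _, w, ?_, (L.code_injective hw).symm⟩
      exact subset_map_bits (vs := [w]) (by simpa using hvs) List.mem_cons_self
    · obtain ⟨c', hc', h⟩ := acc_dec_sound _ _ _ _ _ _ h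
      obtain ⟨w, hw, h⟩ := acc_choose_sound hxs hl h
      obtain ⟨l', hl', hlen, hη⟩ := ih hw h
      refine ⟨l', hl', ?_, hη⟩
      rw [List.length_append, List.length_singleton] at hlen
      omega

/-- Without repetitions, selecting by address yields a single word, as a label query demands. -/
theorem acc_main_goal {c : List Bool} {l : List ℕ} (hnd : l.Nodup) {w : ℕ} (hw : w ∈ l)
    (hV : w ∈ H.V) (hη : H.label w = η) :
    Acc H.oracle (2 * L.size η + 4 * (delimited (l.map Nat.bits)).length + 6) .main
      (mainMem xs η c l) := by
  have hf : (l.map Nat.bits).filter (fun u => bval u == w) = [w.bits] := by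
    rw [List.filter_map]
    have : ((fun u => bval u == w) ∘ Nat.bits) = (· == w) := by
      funext n
      simp [bval_bits]
    rw [this, List.filter_beq, List.count_eq_one_of_mem hnd hw]
    rfl
  have h := (acc_ask_goal (O := H.oracle) (k := 0) (word c) [] (delimited [w.bits] ++
    word (L.code η)) [] (delimited (xs.map L.code)).reverse [] []
    (delimited (l.map Nat.bits))).2 ((oracle_label H _ _).2 ⟨w, hV, rfl, by rw [hη]⟩)
  have h := acc_sel_complete _ _ (word (L.code η)) _ _ _ [] _ (l.map Nat.bits)
    (fun u => bval u == w) false (by rw [hf, List.append_nil]; exact h)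
  have h := (acc_succ (q := .selStart .goal)).2 (.inl h)
  have h := (acc_move_goal (word c) (word (L.code η)).reverse [] [] _ _ _ _).2 (by simpa using h)
  have h := (acc_succ (q := .main)).2 (.inl h)
  refine h.mono ?_
  rw [List.length_reverse, length_word, Logic.size]
  omega

theorem acc_main_step {c : List Bool} {l : List ℕ} (hxs : ∀ α, α ∈ xs ↔ α ∈ T) (hc : 0 < bval c)
    {w : ℕ} (hw : w ∈ H.V) (h : H.label w ∈ T ∨ ∃ S, (S, w) ∈ H.E ∧ ∀ u ∈ S, u ∈ l) :
    ∃ c', c'.length = c.length ∧ bval c' + 1 = bval c ∧ ∀ k,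
      Acc H.oracle k .main (mainMem xs η c' (l ++ [w])) →
      Acc H.oracle (k + 4 * c.length + 7 * (delimited (xs.map L.code)).length +
        6 * (delimited (l.map Nat.bits)).length + 6 * w.bits.length + 30) .main
        (mainMem xs η c l) := by
  obtain ⟨c', hlen, hval, hc'⟩ := acc_dec_complete (O := H.oracle) (word (L.code η)).reverse []
    (delimited (xs.map L.code)).reverse [] (delimited (l.map Nat.bits)).reverse [] hc
  refine ⟨c', hlen, hval, fun k hk => ?_⟩
  suffices hch : Acc H.oracle (k + 7 * (delimited (xs.map L.code)).length +
      6 * (delimited (l.map Nat.bits)).length + 6 * w.bits.length + 21) .choose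
      (mainMem xs η c' l) by
    refine ((acc_succ (q := .main)).2 (.inr (hc' _ hch))).mono ?_
    omega
  have hk : Acc H.oracle k .main ⟨word c', (word (L.code η)).reverse, [], [],
      (delimited (xs.map L.code)).reverse, [],
      (delimited (l.map Nat.bits ++ [w.bits])).reverse, []⟩ := by
    simpa [mainMem] using hk
  rcases h with h | ⟨S, hS, hSl⟩
  · have h1 := acc_new_complete (word c') (word (L.code η)).reverse
      (.sep :: (word (L.code (H.label w)) ++ [])) [] (delimited (xs.map L.code)).reverse [] .thy
      (l.map Nat.bits) w.bits (fun _ => false) (by simp) (by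
        have hq : delimited ((l.map Nat.bits).filter fun _ => false) ++
            (word w.bits ++ (Sym.sep :: (word (L.code (H.label w)) ++ []))) =
            delimited [w.bits] ++ word (L.code (H.label w)) := by
          simp [delimited]
        rw [hq]
        exact (oracle_label H _ _).2 ⟨w, hw, rfl, rfl⟩) hk
    have h2 := acc_skip_complete (word c') (word (L.code η)).reverse [] [] []
      (delimited (l.map Nat.bits)).reverse [] (ws := xs.map L.code)
      (List.mem_map_of_mem ((hxs _).2 h)) h1
    refine ((acc_succ (q := .choose)).2 (.inl h2)).mono ?_
    rw [List.length_nil]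
    omega
  · have h1 := acc_new_complete (word c') (word (L.code η)).reverse
      [] [] (delimited (xs.map L.code)).reverse [] .edge
      (l.map Nat.bits) w.bits (fun u => decide (bval u ∈ S)) (by simp) (by
        rw [List.append_nil]
        -- The sources are listed in the order of `l`; the oracle depends only on their set.
        refine (oracle_edge H _ _).2 ⟨l.filter fun u => decide (u ∈ S), w, ?_, rfl, ?_⟩
        · rw [List.filter_map]
          congr 2
          funext n
          simp [bval_bits]
        · convert hS using 2
          ext u
          simpa using hSl u) hk
    refine ((acc_succ (q := .choose)).2 (.inr h1)).mono ?_
    omega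

theorem length_delimited_map_bits_le {l : List ℕ} {b : ℕ} (h : ∀ w ∈ l, w.bits.length ≤ b) :
    (delimited (l.map Nat.bits)).length ≤ l.length * (b + 1) := by
  induction l with
  | nil => simp [delimited]
  | cons w l ih =>
    have h1 := ih fun u hu => h u (List.mem_cons_of_mem _ hu)
    have h2 := h w List.mem_cons_self
    rw [List.map_cons, delimited_cons, List.length_append, List.length_cons, length_word,
      List.length_cons, Nat.succ_mul]
    omega

/-- `K` bounds the cost of every round uniformly: it is computed from the full list, so it also
covers all prefixes. -/
theorem acc_main_list {c : List Bool} {l : List ℕ} (hxs : ∀ α, α ∈ xs ↔ α ∈ T)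
    (hl : H.ValidList T l) {b K : ℕ} (hb : ∀ w ∈ l, w.bits.length ≤ b)
    (hK : 4 * c.length + 7 * (delimited (xs.map L.code)).length +
      6 * (l.length * (b + 1)) + 6 * b + 30 ≤ K) (hc : l.length ≤ bval c) :
    ∃ c', bval c' + l.length = bval c ∧ c'.length = c.length ∧ ∀ k,
      Acc H.oracle k .main (mainMem xs η c' l) →
      Acc H.oracle (k + l.length * K) .main (mainMem xs η c []) := by
  induction hl with
  | nil => exact ⟨c, rfl, rfl, fun k h => by simpa using h⟩
  | @snoc l w hl hw h ih =>
    rw [List.length_append, List.length_singleton] at hc hK ⊢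
    have hbl : ∀ w ∈ l, w.bits.length ≤ b := fun u hu => hb u (List.mem_append_left _ hu)
    have hmul : l.length * (b + 1) ≤ (l.length + 1) * (b + 1) := by gcongr; omega
    obtain ⟨c₁, hc₁, hlen₁, h₁⟩ := ih hbl (by omega) (by omega)
    obtain ⟨c₂, hlen₂, hc₂, h₂⟩ := acc_main_step (η := η) hxs (c := c₁) (by omega) hw h
    refine ⟨c₂, by omega, by omega, fun k hk => ?_⟩
    refine (h₁ _ (h₂ k hk)).mono ?_
    have hd := length_delimited_map_bits_le hbl
    have hbw := hb w (List.mem_append_right _ List.mem_cons_self)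
    have hsucc : (l.length + 1) * K = l.length * K + K := by ring
    rw [hlen₁, hsucc]
    omega

end Loop

/-! ### Time bounds and complexity classes -/

theorem bits_length_le {w b : ℕ} (h : w < 2 ^ b) : w.bits.length ≤ b := by
  rw [Nat.size_eq_bits_len]
  exact Nat.size_le.2 h

theorem exists_acceptsIn_guesser_iff {O : List Sym → Prop} {k : ℕ} {x : List Sym} :
    (∃ t ≤ k, guesser.AcceptsIn O x t) ↔ Acc O k .parse ⟨x, [], [], [], [], [], [], []⟩ := by
  have : guesser.init x = ⟨St.parse, Mem.get ⟨x, [], [], [], [], [], [], []⟩⟩ := by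
    refine congrArg (Machine.Cfg.mk _) ?_
    funext y
    cases y <;> rfl
  unfold Machine.AcceptsIn
  rw [this]
  rfl

theorem eval_le_eval (p : Polynomial ℕ) {a b : ℕ} (h : a ≤ b) : p.eval a ≤ p.eval b := by
  simp only [Polynomial.eval_eq_sum, Polynomial.sum]
  gcongr

section

variable {L : Logic.{u, v}}

theorem sum_le_sum_map_of_subset {α : Type*} (f : α → ℕ) {T : Finset α} {xs : List α}
    (h : ∀ a ∈ T, a ∈ xs) : ∑ a ∈ T, f a ≤ (xs.map f).sum := by
  classical
  calc ∑ a ∈ T, f a ≤ ∑ a ∈ xs.toFinset, f a :=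
        Finset.sum_le_sum_of_subset fun a ha => List.mem_toFinset.2 (h a ha)
    _ ≤ (xs.map f).sum := by
        clear h
        induction xs with
        | nil => simp
        | cons a xs ih =>
          rw [List.toFinset_cons, List.map_cons, List.sum_cons]
          by_cases ha : a ∈ xs.toFinset
          · rw [Finset.insert_eq_of_mem ha]
            omega
          · rw [Finset.sum_insert ha]
            omega

theorem length_delimited (ws : List (List Bool)) :
    (delimited ws).length = (ws.map fun w => w.length + 1).sum := by
  simp [delimited, length_word, List.length_flatMap]

variable {D : Deriver L}

theorem Deriver.Instance.encode_eq (i : D.Instance) :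
    i.encode = delimited (i.listing.map L.code) ++
      (.sep :: (word (L.code i.goal) ++ .sep :: word i.bound.bits)) := by
  simp [Deriver.Instance.encode, delimited, List.flatMap_map, binary]

theorem Deriver.Instance.length_encode (i : D.Instance) :
    i.encode.length = (delimited (i.listing.map L.code)).length + L.size i.goal +
      i.bound.bits.length + 2 := by
  rw [encode_eq]
  simp [length_word, Logic.size]
  omega

/-- Repetitions in the listing only lengthen the input. -/
theorem Deriver.Instance.size_le_length_encode (i : D.Instance) :
    L.theorySize i.theory + L.size i.goal ≤ i.encode.length := by
  have h1 : L.theorySize i.theory ≤ (i.listing.map L.size).sum :=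
    sum_le_sum_map_of_subset L.size fun α hα => (i.mem_listing α).2 hα
  have h2 : (i.listing.map L.size).sum ≤ (delimited (i.listing.map L.code)).length := by
    rw [length_delimited, List.map_map]
    exact List.sum_le_sum fun α _ => Nat.le_succ _
  rw [length_encode]
  omega

theorem acc_parse_encode {O : List Sym → Prop} {k : ℕ} (i : D.Instance) :
    Acc O (k + 2 * (delimited (i.listing.map L.code)).length + 2 * (L.code i.goal).length + 2)
        .parse ⟨i.encode, [], [], [], [], [], [], []⟩ ↔
      Acc O k .main (mainMem i.listing i.goal i.bound.bits []) := by
  rw [i.encode_eq]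
  refine acc_parse _ _ ?_ _
  intro w hw
  obtain ⟨α, -, rfl⟩ := List.mem_map.1 hw
  exact L.code_ne_nil α

/-- Everything that `guesser` accepts is a yes-instance. -/
theorem yes_of_acc (i : D.Instance) {k : ℕ}
    (h : Acc (D.MPbinary.oracle i) k .parse ⟨D.MPbinary.encode i, [], [], [], [], [], [], []⟩) :
    D.MPbinary.Yes i := by
  have h := (acc_parse_encode i).1 (h.mono (k' := k +
    2 * (delimited (i.listing.map L.code)).length + 2 * (L.code i.goal).length + 2) (by omega))
  obtain ⟨l, hl, hlen, g, hg, hη⟩ := acc_main_sound i.mem_listing .nil h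
  rw [bval_bits, List.length_nil, Nat.zero_add] at hlen
  obtain ⟨p, hp, hcard⟩ := D.exists_admissible_of_validList hl hg hη
  exact ⟨p, hp, hcard.trans hlen⟩

/-- Here `s` is the size of the derivation structure, `m` the length of the list, `b` the address
length, and `x`, `y`, `z` are the lengths of the theory, goal and counter in the input. -/
theorem time_bound {s N b m x y z : ℕ} (hm : m ≤ s + 1) (hN : x + y + z ≤ N) :
    2 * y + 4 * (m * (b + 1)) + 6 + m * (4 * z + 7 * x + 6 * (m * (b + 1)) + 6 * b + 30) + 2 * x +
      2 * y + 2 ≤ 65 * (s + 2) ^ 2 * (N + 1) * (b + 2) := by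
  have h1 : 2 * y + 4 * (m * (b + 1)) + 6 + m * (4 * z + 7 * x + 6 * (m * (b + 1)) + 6 * b + 30) +
      2 * x + 2 * y + 2 ≤ 4 * N + 4 * ((s + 2) * (b + 1)) + 6 +
        (s + 2) * (7 * N + 6 * ((s + 2) * (b + 1)) + 6 * b + 30) + 2 := by
    have hm' : m ≤ s + 2 := by omega
    have h2 : m * (b + 1) ≤ (s + 2) * (b + 1) := Nat.mul_le_mul_right _ hm'
    have h3 : m * (4 * z + 7 * x + 6 * (m * (b + 1)) + 6 * b + 30) ≤
        (s + 2) * (7 * N + 6 * ((s + 2) * (b + 1)) + 6 * b + 30) :=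
      Nat.mul_le_mul hm' (by omega)
    omega
  -- The witness is the multiplied-out difference of the two sides.
  refine h1.trans (Nat.le.intro (k := 420 + 216 * b + 502 * N + 260 * N * b + 462 * s +
    226 * s * b + 513 * s * N + 260 * s * N * b +
    124 * s ^ 2 + 59 * s ^ 2 * b + 130 * s ^ 2 * N + 65 * s ^ 2 * N * b) ?_)
  ring

/-- `guesser` accepts every yes-instance fast enough. -/
theorem acc_of_yes (i : D.Instance) {b : ℕ}
    (hb : ∀ w ∈ (D.out i.theory i.goal).V, w < 2 ^ b) (h : D.MPbinary.Yes i) :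
    Acc (D.MPbinary.oracle i)
      (65 * ((D.out i.theory i.goal).size + 2) ^ 2 * ((D.MPbinary.encode i).length + 1) * (b + 2))
      .parse ⟨D.MPbinary.encode i, [], [], [], [], [], [], []⟩ := by
  obtain ⟨p, hp, hcard⟩ := h
  obtain ⟨l, hl, hnd, hlp, hls, g, hg, hη⟩ := hp.exists_validList
  have hlV : ∀ w ∈ l, w ∈ (D.out i.theory i.goal).V := by
    obtain ⟨rk, hrk⟩ := hl.founded
    exact fun w hw => (hrk w (List.mem_toFinset.2 hw)).1
  have hlb : ∀ w ∈ l, w.bits.length ≤ b := fun w hw => bits_length_le (hb w (hlV w hw))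
  obtain ⟨c', -, -, hc'⟩ := acc_main_list (η := (i.goal : L.Sentence)) (c := i.bound.bits)
    i.mem_listing hl hlb le_rfl (by rw [bval_bits]; omega)
  have h := hc' _ (acc_main_goal hnd hg (hlV g hg) hη)
  refine ((acc_parse_encode i).2 h).mono ?_
  have hd := length_delimited_map_bits_le hlb
  have hN : (D.MPbinary.encode i).length = _ := i.length_encode
  have := time_bound (b := b) hls (x := (delimited (i.listing.map L.code)).length)
    (y := L.size i.goal) (z := i.bound.bits.length) (N := (D.MPbinary.encode i).length) (by omega)
  refine le_trans ?_ this
  have hsize : L.size i.goal = (L.code i.goal).length := rfl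
  omega

theorem inNTime_of_bound (D : Deriver L) {f : ℕ → ℕ}
    (hf : ∀ i : D.Instance, ∃ b, (∀ w ∈ (D.out i.theory i.goal).V, w < 2 ^ b) ∧
      65 * ((D.out i.theory i.goal).size + 2) ^ 2 * (i.encode.length + 1) * (b + 2) ≤
        f i.encode.length) :
    D.MPbinary.InNTime f := by
  refine ⟨guesser, fun i => ⟨fun h => ?_, fun h t ht => h ?_⟩⟩
  · obtain ⟨b, hb, hle⟩ := hf i
    exact exists_acceptsIn_guesser_iff.2 ((acc_of_yes i hb h).mono hle)
  · exact yes_of_acc i (exists_acceptsIn_guesser_iff.1 ⟨t, le_rfl, ht⟩)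

theorem Deriver.MPbinary_inNP (D : Deriver L) (hD : D.HasPolynomialIndices)
    (hp : D.IsPolynomial) : D.MPbinary.InNP := by
  obtain ⟨q, hq⟩ := hD
  obtain ⟨p, hp⟩ := hp
  refine ⟨65 * (p + 2) ^ 2 * (Polynomial.X + 1) * (q + 2), inNTime_of_bound D fun i => ?_⟩
  refine ⟨q.eval i.encode.length, fun w hw => (hq _ _ w hw).trans_le ?_, ?_⟩
  · exact Nat.pow_le_pow_right (by norm_num) (eval_le_eval q i.size_le_length_encode)
  · have := (hp i.theory i.goal).trans (eval_le_eval p i.size_le_length_encode)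
    simp only [Polynomial.eval_mul, Polynomial.eval_add, Polynomial.eval_pow, Polynomial.eval_X,
      Polynomial.eval_ofNat, Polynomial.eval_one]
    gcongr

theorem Deriver.MPbinary_inNExpTime (D : Deriver L) (hD : D.HasPolynomialIndices)
    (hp : D.IsExponential) : D.MPbinary.InNExpTime := by
  obtain ⟨q, hq⟩ := hD
  obtain ⟨p, hp⟩ := hp
  -- One summand per factor of the time bound: `65 ≤ 2 ^ 7`, the square of the size contributes `(p
  -- + 2) * 2`, and the other two factors are estimated by `a < 2 ^ a`.
  refine ⟨7 + (p + 2) * 2 + (Polynomial.X + 1) + (q + 2), inNTime_of_bound D fun i => ?_⟩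
  refine ⟨q.eval i.encode.length, fun w hw => (hq _ _ w hw).trans_le ?_, ?_⟩
  · exact Nat.pow_le_pow_right (by norm_num) (eval_le_eval q i.size_le_length_encode)
  · have h1 := (hp i.theory i.goal).trans (Nat.pow_le_pow_right (by norm_num)
      (eval_le_eval p i.size_le_length_encode))
    simp only [Polynomial.eval_mul, Polynomial.eval_add, Polynomial.eval_X,
      Polynomial.eval_ofNat, Polynomial.eval_one, pow_add _ (_ + _) _, pow_add _ 7 _, pow_mul]
    have h2 : (D.out i.theory i.goal).size + 2 ≤ 2 ^ (p.eval i.encode.length + 2) := by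
      have := Nat.one_le_two_pow (n := p.eval i.encode.length)
      rw [pow_add]
      omega
    have h3 : i.encode.length + 1 ≤ 2 ^ (i.encode.length + 1) := Nat.lt_two_pow_self.le
    have h4 : q.eval i.encode.length + 2 ≤ 2 ^ (q.eval i.encode.length + 2) :=
      Nat.lt_two_pow_self.le
    exact Nat.mul_le_mul (Nat.mul_le_mul (Nat.mul_le_mul (by norm_num)
      (Nat.pow_le_pow_left h2 2)) h3) h4

end

end MinProof

theorem mainTheorem6 {L : MinProof.Logic.{u, v}} (D : MinProof.Deriver L)
    (hD : D.HasPolynomialIndices) :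
    (D.IsPolynomial → D.MPbinary.InNP) ∧ (D.IsExponential → D.MPbinary.InNExpTime) :=
  ⟨D.MPbinary_inNP hD, D.MPbinary_inNExpTime hD⟩
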